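/- Let $\mathbb{S}^3$ be the Lie group of unit quaternions, with the round metric induced from $\mathbb{H}=\mathbb{R}^4$, and let $\mathcal{Q}_8=\langle i,j\rangle\le\mathbb{S}^3$ be the quaternion group. Let $T(\mathbb{R})\le SO_3(\mathbb{R})$ be the (finite) subgroup of diagonal matrices and let $\mathcal{F}(\mathbb{R}):=SO_3(\mathbb{R})/T(\mathbb{R})$ be the real flag manifold of type $A_2$; the quotients $\mathbb{S}^3/\mathcal{Q}_8$ and $SO_3(\mathbb{R})/T(\mathbb{R})$ are by right multiplication. Let $\kappa$ be the Killing form $\kappa(X,Y)=\mathrm{tr}(\mathrm{ad}(X)\circ\mathrm{ad}(Y))$ of the Lie algebra $\mathfrak{so}_3(\mathbb{R})$ of skew-symmetric $3\times 3$ matrices, and let $g^8$ be the left-invariant Riemannian metric on $SO_3(\mathbb{R})$ given at the identity by $-\frac18\kappa$. Let $\mathrm{B}:\mathbb{S}^3\to SO_3(\mathbb{R})$ be the double cover sending $q$ to the matrix, in the basis $(i,j,k)$ of the space of pure quaternions, of $x\mapsto qxq^{-1}$. There are a unique smooth Riemannian metric $g_{\mathcal{Q}_8}$ on $\mathbb{S}^3/\mathcal{Q}_8$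 and a unique smooth Riemannian metric $\overline{g}^8$ on $\mathcal{F}(\mathbb{R})$ such that the projections $(\mathbb{S}^3,\text{round})\to(\mathbb{S}^3/\mathcal{Q}_8,g_{\mathcal{Q}_8})$ and $(SO_3(\mathbb{R}),g^8)\to(\mathcal{F}(\mathbb{R}),\overline{g}^8)$ are Riemannian submersions; $\mathrm{B}$ induces a diffeomorphism $\phi:\mathbb{S}^3/\mathcal{Q}_8\to\mathcal{F}(\mathbb{R})$, $\phi(q\mathcal{Q}_8)=\mathrm{B}(q)T(\mathbb{R})$; and $\phi$ is an isometry from $(\mathbb{S}^3/\mathcal{Q}_8,g_{\mathcal{Q}_8})$ to $(\mathcal{F}(\mathbb{R}),\overline{g}^8)$, that is, $\overline{g}^8_{\phi(p)}(\mathrm{d}_p\phi(u),\mathrm{d}_p\phi(v))=(g_{\mathcal{Q}_8})_p(u,v)$ for all $p\in\mathbb{S}^3/\mathcal{Q}_8$ and all tangent vectors $u,v$ at $p$. -/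

import Mathlib

open scoped Quaternion Manifold ContDiff Matrix

namespace RealFlag

noncomputable section

/-- The unit sphere of the real quaternions, with quaternion multiplication, and Mathlib's smooth
structure on spheres. -/
abbrev S3 : Type := Metric.sphere (0 : ℍ[ℝ]) 1
/-- The group of real `3 × 3` matrices `A` with `A Aᵀ = 1` and `det A = 1`, topologized as a
subspace of the space of matrices. -/
abbrev SO3 : Type := Matrix.specialOrthogonalGroup (Fin 3) ℝ
/-- The model space of all manifolds below. -/
abbrev E3 : Type := EuclideanSpace ℝ (Fin 3)


instance : Fact (Module.finrank ℝ ℍ[ℝ] = 3 + 1) := ⟨Quaternion.finrank_eq_four⟩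

theorem SO3.cofactor (A : SO3) : Matrix.adjugate A.1 = A.1ᵀ := by
  have h := Matrix.mem_specialOrthogonalGroup_iff.1 A.2
  have h1 := (Matrix.mem_orthogonalGroup_iff' _ _).1 h.1
  have h2 : A.1.adjugate = A.1ᵀ * (A.1 * A.1.adjugate) := by
    rw [← Matrix.mul_assoc]
    have : A.1ᵀ * A.1 = 1 := h1
    rw [this, one_mul]
  rw [h2, Matrix.mul_adjugate, h.2, one_smul, mul_one]

/-- The rotation `(1 + X) (1 - X)⁻¹ ∈ SO(3)` (Cayley transform), written out in closed form, where
`X = !![0, -x₂, x₁; x₂, 0, -x₀; -x₁, x₀, 0]`. -/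
def rodrigues (x : E3) : Matrix (Fin 3) (Fin 3) ℝ :=
  (1 + x 0 ^ 2 + x 1 ^ 2 + x 2 ^ 2)⁻¹ •
    !![1 + x 0 ^ 2 - x 1 ^ 2 - x 2 ^ 2, 2 * (x 0 * x 1 - x 2), 2 * (x 0 * x 2 + x 1);
       2 * (x 0 * x 1 + x 2), 1 - x 0 ^ 2 + x 1 ^ 2 - x 2 ^ 2, 2 * (x 1 * x 2 - x 0);
       2 * (x 0 * x 2 - x 1), 2 * (x 1 * x 2 + x 0), 1 - x 0 ^ 2 - x 1 ^ 2 + x 2 ^ 2]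

theorem rodrigues_mem (x : E3) : rodrigues x ∈ Matrix.specialOrthogonalGroup (Fin 3) ℝ := by
  have hn : (1 + x 0 ^ 2 + x 1 ^ 2 + x 2 ^ 2) ≠ 0 := by positivity
  rw [Matrix.mem_specialOrthogonalGroup_iff, Matrix.mem_orthogonalGroup_iff]
  constructor
  · ext i j
    fin_cases i <;> fin_cases j <;>
      simp [rodrigues, Matrix.mul_apply, Fin.sum_univ_three] <;>
      field_simp <;> ring
  · simp [rodrigues, Matrix.det_fin_three]
    field_simp
    ring

/-- Inverse Cayley transform on `SO(3)`: the vector of the skew-symmetric matrix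
`(A - Aᵀ) / (1 + tr A)`. -/
def invRodrigues (A : Matrix (Fin 3) (Fin 3) ℝ) : E3 :=
  (1 + A.trace)⁻¹ • !₂[A 2 1 - A 1 2, A 0 2 - A 2 0, A 1 0 - A 0 1]

theorem trace_rodrigues (x : E3) :
    1 + (rodrigues x).trace = 4 * (1 + x 0 ^ 2 + x 1 ^ 2 + x 2 ^ 2)⁻¹ := by
  have hn : (1 + x 0 ^ 2 + x 1 ^ 2 + x 2 ^ 2) ≠ 0 := by positivity
  simp [rodrigues, Matrix.trace_fin_three]
  field_simp
  ring

theorem invRodrigues_rodrigues (x : E3) : invRodrigues (rodrigues x) = x := by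
  have hn : (1 + x 0 ^ 2 + x 1 ^ 2 + x 2 ^ 2) ≠ 0 := by positivity
  rw [invRodrigues, trace_rodrigues]
  ext i
  fin_cases i <;> simp [rodrigues] <;> field_simp <;> ring

theorem rodrigues_invRodrigues (A : SO3) (h : 1 + A.1.trace ≠ 0) :
    rodrigues (invRodrigues A.1) = A.1 := by
  have hc := SO3.cofactor A
  have h1 := (Matrix.mem_orthogonalGroup_iff _ _).1 (Matrix.mem_specialOrthogonalGroup_iff.1 A.2).1
  have h2 := (Matrix.mem_orthogonalGroup_iff' _ _).1 (Matrix.mem_specialOrthogonalGroup_iff.1 A.2).1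
  obtain ⟨A, hA⟩ := A
  simp only [Matrix.trace_fin_three] at h hc h1 h2 ⊢
  rw [Matrix.adjugate_fin_three] at hc
  have e (i j) := congrFun (congrFun hc i) j
  have f (i j) := congrFun (congrFun h1 i) j
  have g (i j) := congrFun (congrFun h2 i) j
  simp only [Matrix.mul_apply, Fin.sum_univ_three] at f g
  have e00 := e 0 0
  have e01 := e 0 1
  have e02 := e 0 2
  have e10 := e 1 0
  have e11 := e 1 1
  have e12 := e 1 2
  have e20 := e 2 0
  have e21 := e 2 1
  have e22 := e 2 2
  have f00 := f 0 0
  have f01 := f 0 1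
  have f02 := f 0 2
  have f11 := f 1 1
  have f12 := f 1 2
  have f22 := f 2 2
  have g00 := g 0 0
  have g01 := g 0 1
  have g02 := g 0 2
  have g11 := g 1 1
  have g12 := g 1 2
  have g22 := g 2 2
  clear e f g hc h1 h2 hA
  simp at e00 e01 e02 e10 e11 e12 e20 e21 e22 f00 f01 f02 f11 f12 f22 g00 g01 g02 g11 g12 g22
  have hsq : (1 + (invRodrigues A 0) ^ 2 + (invRodrigues A 1) ^ 2 + (invRodrigues A 2) ^ 2)
      = 4 * (1 + (A 0 0 + A 1 1 + A 2 2))⁻¹ := by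
    simp [invRodrigues, Matrix.trace_fin_three]
    field_simp
    grind
  rw [rodrigues, hsq]
  ext i j
  fin_cases i <;> fin_cases j <;> simp [invRodrigues, Matrix.trace_fin_three] <;>
    field_simp <;> grind

instance : IsTopologicalGroup SO3 where
  continuous_mul := by
    refine Continuous.subtype_mk ?_ _
    exact (continuous_subtype_val.comp continuous_fst).matrix_mul
      (continuous_subtype_val.comp continuous_snd)
  continuous_inv := by
    refine Continuous.subtype_mk ?_ _
    exact continuous_subtype_val.matrix_transpose

theorem continuous_rodrigues : Continuous rodrigues := by
  unfold rodrigues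
  have h : Continuous fun x : E3 => (1 + x 0 ^ 2 + x 1 ^ 2 + x 2 ^ 2)⁻¹ :=
    Continuous.inv₀ (by fun_prop) fun x => by positivity
  refine h.smul ?_
  refine continuous_matrix fun i j => ?_
  fin_cases i <;> fin_cases j <;> simp <;> fun_prop

/-- The chart of `SO(3)` centred at `R`: `R · Cayley(X) ↦ X`, on the open set of those `S` for
which `R⁻¹ S` is not a half-turn. -/
def SO3.chart (R : SO3) : OpenPartialHomeomorph SO3 E3 where
  toFun S := invRodrigues (R⁻¹ * S).1
  invFun x := R * ⟨rodrigues x, rodrigues_mem x⟩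
  source := {S | 1 + (R⁻¹ * S).1.trace ≠ 0}
  target := Set.univ
  map_source' _ _ := trivial
  map_target' x _ := by
    have hn : (1 + x 0 ^ 2 + x 1 ^ 2 + x 2 ^ 2) ≠ 0 := by positivity
    simp only [inv_mul_cancel_left, Set.mem_ofPred_eq, trace_rodrigues]
    positivity
  left_inv' S hS := by
    have h := rodrigues_invRodrigues (R⁻¹ * S) hS
    have : (⟨rodrigues (invRodrigues (R⁻¹ * S).1), rodrigues_mem _⟩ : SO3) = R⁻¹ * S :=
      Subtype.ext h
    rw [this, mul_inv_cancel_left]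
  right_inv' x _ := by
    simp only [inv_mul_cancel_left]
    exact invRodrigues_rodrigues x
  open_source := by
    refine isOpen_ne_fun ?_ continuous_const
    exact continuous_const.add
      ((continuous_subtype_val.comp (continuous_const.mul continuous_id)).matrix_trace)
  open_target := isOpen_univ
  continuousOn_toFun := by
    have hc : Continuous fun S : SO3 => (R⁻¹ * S).1 :=
      continuous_subtype_val.comp (continuous_const.mul continuous_id)
    unfold invRodrigues
    refine ContinuousOn.smul (ContinuousOn.inv₀ ?_ fun S hS => hS) ?_
    · exact (continuous_const.add hc.matrix_trace).continuousOn
    · refine Continuous.continuousOn ?_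
      refine (PiLp.continuous_toLp 2 _).comp (continuous_pi fun i => ?_)
      fin_cases i <;> simp <;>
        exact (hc.matrix_elem _ _).sub (hc.matrix_elem _ _)
  continuousOn_invFun :=
    (continuous_const.mul (continuous_rodrigues.subtype_mk _)).continuousOn

/-- The smooth structure of `SO(3)`. The results `SO3.contMDiff_entry` and
`SO3.contMDiff_of_entries` below show that it is that of an embedded submanifold of the space of
matrices: a map into `SO(3)` is smooth if and only if its matrix entries are. -/
instance : ChartedSpace E3 SO3 where
  atlas := Set.range SO3.chart
  chartAt := SO3.chart
  mem_chart_source R := by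
    simp only [SO3.chart, Set.mem_ofPred_eq, inv_mul_cancel]
    simp
    norm_num
  chart_mem_atlas R := ⟨R, rfl⟩

theorem contDiff_rodrigues (i j : Fin 3) : ContDiff ℝ ∞ fun x : E3 => rodrigues x i j := by
  have hn : ContDiff ℝ ∞ fun x : E3 => (1 + x 0 ^ 2 + x 1 ^ 2 + x 2 ^ 2)⁻¹ :=
    ContDiff.inv (by fun_prop) fun x => by positivity
  fin_cases i <;> fin_cases j <;> simp [rodrigues] <;>
    exact hn.mul (by fun_prop)

theorem contDiffOn_invRodrigues {f : E3 → Matrix (Fin 3) (Fin 3) ℝ} {s : Set E3}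
    (hf : ∀ i j, ContDiff ℝ ∞ fun x => f x i j) (hs : ∀ x ∈ s, 1 + (f x).trace ≠ 0) :
    ContDiffOn ℝ ∞ (fun x => invRodrigues (f x)) s := by
  have ht : ContDiffOn ℝ ∞ (fun x => (1 + (f x).trace)⁻¹) s := by
    refine ContDiffOn.inv (ContDiff.contDiffOn ?_) hs
    simp only [Matrix.trace_fin_three]
    exact contDiff_const.add (((hf 0 0).add (hf 1 1)).add (hf 2 2))
  rw [contDiffOn_euclidean]
  intro i
  fin_cases i <;> simp [invRodrigues] <;>
    exact ht.mul ((hf _ _).sub (hf _ _)).contDiffOn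

instance : IsManifold (𝓡 3) ∞ SO3 :=
  isManifold_of_contDiffOn (𝓡 3) ∞ SO3 (by
    rintro _ _ ⟨R, rfl⟩ ⟨R', rfl⟩
    have h : ∀ i j, ContDiff ℝ ∞ fun x : E3 =>
        (R'⁻¹ * (R * (⟨rodrigues x, rodrigues_mem x⟩ : SO3))).1 i j := by
      intro i j
      have : ∀ x : E3, (R'⁻¹ * (R * (⟨rodrigues x, rodrigues_mem x⟩ : SO3))).1 i j
          = ∑ k, (R'⁻¹ * R).1 i k * rodrigues x k j := by
        intro x
        rw [← mul_assoc]
        exact Matrix.mul_apply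
      simp only [this]
      exact ContDiff.sum fun k _ => contDiff_const.mul (contDiff_rodrigues k j)
    have h2 := contDiffOn_invRodrigues (s := ((SO3.chart R).symm.trans (SO3.chart R')).source) h
      (fun x hx => by simpa [SO3.chart] using hx)
    simp only [mfld_simps, Function.comp_def] at h2 ⊢
    exact h2)

theorem SO3.contMDiff_entry (i j : Fin 3) :
    ContMDiff (𝓡 3) 𝓘(ℝ, ℝ) ∞ fun S : SO3 => S.1 i j := by
  rw [contMDiff_iff]
  refine ⟨continuous_subtype_val.matrix_elem i j, fun R y => ?_⟩
  refine ContDiff.contDiffOn ?_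
  have : ∀ x : E3, (R * (⟨rodrigues x, rodrigues_mem x⟩ : SO3)).1 i j
      = ∑ k, R.1 i k * rodrigues x k j := fun x => Matrix.mul_apply
  change ContDiff ℝ ∞ fun x : E3 => (R * (⟨rodrigues x, rodrigues_mem x⟩ : SO3)).1 i j
  simp only [this]
  exact ContDiff.sum fun k _ => contDiff_const.mul (contDiff_rodrigues k j)

section
variable {E H M : Type*} [NormedAddCommGroup E] [NormedSpace ℝ E] [TopologicalSpace H]
  {I : ModelWithCorners ℝ E H} [TopologicalSpace M] [ChartedSpace H M] [IsManifold I ∞ M]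

theorem SO3.contMDiff_of_entries {f : M → SO3}
    (hf : ∀ i j, ContMDiff I 𝓘(ℝ, ℝ) ∞ fun x => (f x).1 i j) : ContMDiff I (𝓡 3) ∞ f := by
  rw [contMDiff_iff_target]
  refine ⟨Continuous.subtype_mk (continuous_matrix fun i j => (hf i j).continuous) _, fun R => ?_⟩
  have h : ∀ i j, ContMDiff I 𝓘(ℝ, ℝ) ∞ fun x => (R⁻¹ * f x).1 i j := by
    intro i j
    have : ∀ x, (R⁻¹ * f x).1 i j = ∑ k, (R⁻¹).1 i k * (f x).1 k j := fun x => Matrix.mul_apply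
    simp only [this]
    exact contMDiff_finsetSum fun k _ => contMDiff_const.mul (hf k j)
  have ht : ContMDiffOn I 𝓘(ℝ, ℝ) ∞ (fun x => (1 + (R⁻¹ * f x).1.trace)⁻¹)
      (f ⁻¹' (SO3.chart R).source) := by
    refine ContMDiffOn.inv₀ (ContMDiff.contMDiffOn ?_) fun x hx => hx
    simp only [Matrix.trace_fin_three]
    exact contMDiff_const.add (((h 0 0).add (h 1 1)).add (h 2 2))
  have hs : extChartAt (𝓡 3) R = (SO3.chart R).toPartialEquiv := by
    simp [extChartAt, chartAt, ChartedSpace.chartAt]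
  rw [hs]
  change ContMDiffOn I 𝓘(ℝ, E3) ∞ (fun x => invRodrigues (R⁻¹ * f x).1)
    (f ⁻¹' (SO3.chart R).source)
  have hp : ContMDiffOn I 𝓘(ℝ, Fin 3 → ℝ) ∞
      (fun x => (EuclideanSpace.equiv (Fin 3) ℝ) (invRodrigues (R⁻¹ * f x).1))
      (f ⁻¹' (SO3.chart R).source) := by
    rw [contMDiffOn_pi_space]
    intro i
    fin_cases i <;> simp [invRodrigues] <;>
      exact ht.mul ((h _ _).sub (h _ _)).contMDiffOn
  exact (EuclideanSpace.equiv (Fin 3) ℝ).symm.contDiff.contMDiff.comp_contMDiffOn hp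
end

instance : LieGroup (𝓡 3) ∞ SO3 where
  contMDiff_mul := by
    refine SO3.contMDiff_of_entries fun i j => ?_
    have : ∀ p : SO3 × SO3, (p.1 * p.2).1 i j = ∑ k, p.1.1 i k * p.2.1 k j :=
      fun p => Matrix.mul_apply
    simp only [this]
    exact contMDiff_finsetSum fun k _ =>
      ((SO3.contMDiff_entry i k).comp contMDiff_fst).mul
        ((SO3.contMDiff_entry k j).comp contMDiff_snd)
  contMDiff_inv := SO3.contMDiff_of_entries fun i j => SO3.contMDiff_entry j i

theorem S3.coe_inv (q : S3) : ((q⁻¹ : S3) : ℍ[ℝ]) = star (q : ℍ[ℝ]) := by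
  rw [Metric.unitSphere.coe_inv, Quaternion.inv_def, Quaternion.normSq_eq_norm_mul_self]
  simp

instance : LieGroup (𝓡 3) ∞ S3 where
  contMDiff_mul := by
    apply ContMDiff.codRestrict_sphere
    let c : S3 → ℍ[ℝ] := (↑)
    have h₂ : ContMDiff (𝓘(ℝ, ℍ[ℝ]).prod 𝓘(ℝ, ℍ[ℝ])) 𝓘(ℝ, ℍ[ℝ]) ∞
        fun z : ℍ[ℝ] × ℍ[ℝ] => z.fst * z.snd := by
      rw [contMDiff_iff]
      exact ⟨continuous_mul, fun x y => contDiff_mul.contDiffOn⟩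
    suffices h₁ : ContMDiff _ _ _ (Prod.map c c) from h₂.comp h₁
    apply ContMDiff.prodMap <;> exact contMDiff_coe_sphere
  contMDiff_inv := by
    apply ContMDiff.codRestrict_sphere
    change ContMDiff (𝓡 3) 𝓘(ℝ, ℍ[ℝ]) ∞ fun q : S3 => ((q⁻¹ : S3) : ℍ[ℝ])
    simp only [S3.coe_inv]
    let c : ℍ[ℝ] →ₗ[ℝ] ℍ[ℝ] :=
      { toFun := star
        map_add' := star_add
        map_smul' := fun r x => by ext <;> simp }
    exact (LinearMap.toContinuousLinearMap c).contDiff.contMDiff.comp contMDiff_coe_sphere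

section Quotient
variable {E H G : Type*} [NormedAddCommGroup E] [NormedSpace ℝ E] [TopologicalSpace H]
  {I : ModelWithCorners ℝ E H} [TopologicalSpace G] [T2Space G] [Group G] [IsTopologicalGroup G]
  [ChartedSpace H G]

theorem isLocalHomeomorph_mk (K : Subgroup G) [Finite K] :
    IsLocalHomeomorph (QuotientGroup.mk : G → G ⧸ K) :=
  (K.isQuotientCoveringMap (K : Set G).toFinite.isDiscrete).isCoveringMap.isLocalHomeomorph

/-- The charts of the quotient `G ⧸ K` (left cosets `gK`) of a Lie group by a finite subgroup are
the local inverses of the projection followed by the charts of `G`. -/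
instance quotientChartedSpace (K : Subgroup G) [Finite K] : ChartedSpace H (G ⧸ K) :=
  (isLocalHomeomorph_mk K).chartedSpace QuotientGroup.mk_surjective

end Quotient

section QuotientManifold
variable {E G : Type*} [NormedAddCommGroup E] [NormedSpace ℝ E]
  [TopologicalSpace G] [T2Space G] [Group G] [IsTopologicalGroup G]
  [ChartedSpace E G] [LieGroup 𝓘(ℝ, E) ∞ G]

instance quotientIsManifold (K : Subgroup G) [Finite K] : IsManifold 𝓘(ℝ, E) ∞ (G ⧸ K) :=
  isManifold_of_contDiffOn 𝓘(ℝ, E) ∞ (G ⧸ K) (by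
    have hl := isLocalHomeomorph_mk K
    rintro _ _ ⟨p, rfl⟩ ⟨q, rfl⟩
    generalize QuotientGroup.mk_surjective.hasRightInverse.choose p = a
    generalize QuotientGroup.mk_surjective.hasRightInverse.choose q = b
    intro z hz
    simp only [mfld_simps, IsLocalHomeomorph.localInverseAt_symm] at hz
    refine ContDiffAt.contDiffWithinAt ?_
    simp only [mfld_simps, IsLocalHomeomorph.localInverseAt_symm, Function.comp_def]
    obtain ⟨⟨hz1, hz2⟩, hz3, hz4⟩ := hz
    set c := (chartAt E a).symm z with hc
    obtain ⟨k, hk⟩ : ∃ k : K, c * k = hl.localInverseAt b (QuotientGroup.mk c) := by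
      have := hl.apply_localInverseAt_of_mem hz3
      exact ⟨⟨_, QuotientGroup.eq.1 this.symm⟩, by simp⟩
    have hev : ∀ᶠ g in nhds c, hl.localInverseAt b (QuotientGroup.mk g) = g * k := by
      have ho : (fun g : G => g * (k : G)) ⁻¹' (hl.localInverseAt b).target ∈ nhds c := by
        refine (continuous_mul_const (k : G)).continuousAt.preimage_mem_nhds ?_
        refine (hl.localInverseAt b).open_target.mem_nhds ?_
        rw [hk]
        exact (hl.localInverseAt b).map_source hz3
      filter_upwards [ho] with g hg
      have h1 := (hl.localInverseAt b).right_inv hg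
      rw [hl.localInverseAt_symm] at h1
      have h2 : (QuotientGroup.mk (g * (k : G)) : G ⧸ K) = QuotientGroup.mk g :=
        QuotientGroup.eq.2 (by simp)
      rw [← h2]
      exact h1
    have hcz : ContinuousAt (chartAt E a).symm z := (chartAt E a).continuousAt_symm hz1
    have hm : ContMDiffAt 𝓘(ℝ, E) 𝓘(ℝ, E) ∞
        (fun x => chartAt E b ((chartAt E a).symm x * (k : G))) z := by
      have h1 : ContMDiffAt 𝓘(ℝ, E) 𝓘(ℝ, E) ∞ (chartAt E a).symm z :=
        (contMDiffOn_chart_symm z hz1).contMDiffAt ((chartAt E a).open_target.mem_nhds hz1)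
      have h2 : ContMDiffAt 𝓘(ℝ, E) 𝓘(ℝ, E) ∞ (fun g : G => g * (k : G)) c :=
        contMDiff_mul_right.contMDiffAt
      have h3 : ContMDiffAt 𝓘(ℝ, E) 𝓘(ℝ, E) ∞ (chartAt E b) (c * (k : G)) := by
        rw [hk]
        exact (contMDiffOn_chart _ hz4).contMDiffAt ((chartAt E b).open_source.mem_nhds hz4)
      exact h3.comp z (h2.comp z h1)
    rw [contMDiffAt_iff_contDiffAt] at hm
    refine hm.congr_of_eventuallyEq ?_
    filter_upwards [hcz.eventually hev] with x hx
    rw [hx])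

end QuotientManifold


/-- The quaternion units `i`, `j`, `k`, for `a = 0, 1, 2`. -/
def S3.unit (a : Fin 3) : S3 :=
  ⟨![⟨0, 1, 0, 0⟩, ⟨0, 0, 1, 0⟩, ⟨0, 0, 0, 1⟩] a, by
    rw [mem_sphere_zero_iff_norm, ← sq_eq_sq₀ (norm_nonneg _) zero_le_one, sq,
      ← Quaternion.normSq_eq_norm_mul_self, Quaternion.normSq_def']
    fin_cases a <;> simp⟩

theorem S3.re_unit (a : Fin 3) : (S3.unit a).1.re = 0 := by fin_cases a <;> rfl

theorem S3.imI_unit (a : Fin 3) : (S3.unit a).1.imI = ![1, 0, 0] a := by fin_cases a <;> rfl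

theorem S3.imJ_unit (a : Fin 3) : (S3.unit a).1.imJ = ![0, 1, 0] a := by fin_cases a <;> rfl

theorem S3.imK_unit (a : Fin 3) : (S3.unit a).1.imK = ![0, 0, 1] a := by fin_cases a <;> rfl

/-- The quaternion group `⟨i, j⟩`. -/
def Q8 : Subgroup S3 := Subgroup.closure {S3.unit 0, S3.unit 1}

theorem S3.normSq (q : S3) :
    q.1.re ^ 2 + q.1.imI ^ 2 + q.1.imJ ^ 2 + q.1.imK ^ 2 = 1 := by
  rw [← Quaternion.normSq_def', Quaternion.normSq_eq_norm_mul_self]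
  simp

theorem Q8.int_coord {q : S3} (hq : q ∈ Q8) :
    ∃ a b c d : ℤ, q.1.re = a ∧ q.1.imI = b ∧ q.1.imJ = c ∧ q.1.imK = d := by
  induction hq using Subgroup.closure_induction with
  | mem x hx =>
    rcases hx with rfl | rfl
    · exact ⟨0, 1, 0, 0, by simp [S3.unit]⟩
    · exact ⟨0, 0, 1, 0, by simp [S3.unit]⟩
  | one => exact ⟨1, 0, 0, 0, by simp⟩
  | mul x y _ _ hx hy =>
    obtain ⟨a, b, c, d, h1, h2, h3, h4⟩ := hx
    obtain ⟨a', b', c', d', h1', h2', h3', h4'⟩ := hy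
    refine ⟨a * a' - b * b' - c * c' - d * d', a * b' + b * a' + c * d' - d * c',
      a * c' - b * d' + c * a' + d * b', a * d' + b * c' - c * b' + d * a', ?_⟩
    rw [Metric.unitSphere.coe_mul, Quaternion.re_mul, Quaternion.imI_mul, Quaternion.imJ_mul,
      Quaternion.imK_mul]
    rw [h1, h2, h3, h4, h1', h2', h3', h4']
    push_cast
    exact ⟨rfl, rfl, rfl, rfl⟩
  | inv x _ hx =>
    obtain ⟨a, b, c, d, h1, h2, h3, h4⟩ := hx
    refine ⟨a, -b, -c, -d, ?_⟩
    rw [S3.coe_inv]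
    simp [h1, h2, h3, h4]

instance : Finite Q8 := by
  let s : Set ℤ := Set.Icc (-1) 1
  have hs : s.Finite := Set.finite_Icc _ _
  let t : Set ℍ[ℝ] := (fun p : ℤ × ℤ × ℤ × ℤ => (⟨p.1, p.2.1, p.2.2.1, p.2.2.2⟩ : ℍ[ℝ])) ''
    (s ×ˢ s ×ˢ s ×ˢ s)
  have ht : t.Finite := (hs.prod (hs.prod (hs.prod hs))).image _
  refine Set.Finite.to_subtype ((ht.preimage Subtype.val_injective.injOn).subset fun q hq => ?_)
  obtain ⟨a, b, c, d, h1, h2, h3, h4⟩ := Q8.int_coord hq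
  have hn := S3.normSq q
  rw [h1, h2, h3, h4] at hn
  norm_cast at hn
  refine ⟨(a, b, c, d), ⟨?_, ?_, ?_, ?_⟩, QuaternionAlgebra.ext h1.symm h2.symm h3.symm h4.symm⟩ <;>
    exact abs_le.1 (by rw [← sq_le_one_iff_abs_le_one]; nlinarith)

/-- The group of diagonal matrices in `SO(3)`. -/
def diagTorus : Subgroup SO3 where
  carrier := {A | A.1.IsDiag}
  one_mem' := Matrix.isDiag_one
  mul_mem' := by
    intro A B hA hB i j hij
    change (A.1 * B.1) i j = 0
    rw [Matrix.mul_apply]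
    refine Finset.sum_eq_zero fun k _ => ?_
    by_cases h : i = k
    · rw [hB (h ▸ hij), mul_zero]
    · rw [hA h, zero_mul]
  inv_mem' := fun {A} hA => Matrix.IsDiag.transpose hA

theorem SO3.mul_transpose (R : SO3) : R.1 * R.1ᵀ = 1 :=
  (Matrix.mem_orthogonalGroup_iff _ _).1 (Matrix.mem_specialOrthogonalGroup_iff.1 R.2).1

theorem SO3.transpose_mul (R : SO3) : R.1ᵀ * R.1 = 1 :=
  (Matrix.mem_orthogonalGroup_iff' _ _).1 (Matrix.mem_specialOrthogonalGroup_iff.1 R.2).1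

instance : Finite diagTorus := by
  have hs : ({1, -1} : Set ℝ).Finite := Set.toFinite _
  have ht : (Set.pi Set.univ fun _ : Fin 3 => ({1, -1} : Set ℝ)).Finite :=
    Set.Finite.pi fun _ => hs
  refine Set.Finite.to_subtype (((ht.image Matrix.diagonal).preimage
    Subtype.val_injective.injOn).subset fun A hA => ?_)
  refine ⟨A.1.diag, fun i _ => ?_, Matrix.IsDiag.diagonal_diag hA⟩
  have h := congrFun (congrFun (SO3.mul_transpose A) i) i
  rw [Matrix.mul_apply, Finset.sum_eq_single i, Matrix.one_apply_eq] at h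
  · exact mul_self_eq_one_iff.1 h
  · intro k _ hk
    rw [hA (Ne.symm hk), zero_mul]
  · simp

/-- The coordinates of a quaternion along `(i, j, k)`. -/
def pureCoord (q : ℍ[ℝ]) (a : Fin 3) : ℝ := ![q.imI, q.imJ, q.imK] a

/-- The matrix in the basis `(i, j, k)` of `x ↦ q x q⁻¹` on the pure quaternions: its column `b`
holds the coordinates of `q u q⁻¹` with `u` the `b`-th unit. -/
def conjMatrix (q : S3) : Matrix (Fin 3) (Fin 3) ℝ :=
  Matrix.of fun a b => pureCoord (q * S3.unit b * q⁻¹ : S3) a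

theorem conjMatrix_eq (q : S3) : conjMatrix q =
    !![q.1.re ^ 2 + q.1.imI ^ 2 - q.1.imJ ^ 2 - q.1.imK ^ 2,
        2 * (q.1.imI * q.1.imJ - q.1.re * q.1.imK), 2 * (q.1.imI * q.1.imK + q.1.re * q.1.imJ);
      2 * (q.1.imI * q.1.imJ + q.1.re * q.1.imK),
        q.1.re ^ 2 - q.1.imI ^ 2 + q.1.imJ ^ 2 - q.1.imK ^ 2,
        2 * (q.1.imJ * q.1.imK - q.1.re * q.1.imI);
      2 * (q.1.imI * q.1.imK - q.1.re * q.1.imJ), 2 * (q.1.imJ * q.1.imK + q.1.re * q.1.imI),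
        q.1.re ^ 2 - q.1.imI ^ 2 - q.1.imJ ^ 2 + q.1.imK ^ 2] := by
  ext i j
  simp only [conjMatrix, Matrix.of_apply]
  rw [Metric.unitSphere.coe_mul, Metric.unitSphere.coe_mul, S3.coe_inv]
  fin_cases i <;> fin_cases j <;> simp [pureCoord, S3.re_unit, S3.imI_unit, S3.imJ_unit, S3.imK_unit] <;>
    ring

theorem conjMatrix_mem (q : S3) : conjMatrix q ∈ Matrix.specialOrthogonalGroup (Fin 3) ℝ := by
  have hq := S3.normSq q
  rw [conjMatrix_eq, Matrix.mem_specialOrthogonalGroup_iff, Matrix.mem_orthogonalGroup_iff]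
  constructor
  · ext i j
    fin_cases i <;> fin_cases j <;>
      simp [Matrix.mul_apply, Fin.sum_univ_three] <;> grind
  · simp [Matrix.det_fin_three]
    grind

/-- The double cover `S³ → SO(3)`, `q ↦ Mat_{(i,j,k)} (x ↦ q x q⁻¹)`. -/
def doubleCover : S3 →* SO3 where
  toFun q := ⟨conjMatrix q, conjMatrix_mem q⟩
  map_one' := by
    refine Subtype.ext ?_
    change conjMatrix 1 = 1
    ext i j
    fin_cases i <;> fin_cases j <;> simp [conjMatrix, pureCoord, S3.unit]
  map_mul' p q := by
    refine Subtype.ext ?_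
    change conjMatrix (p * q) = conjMatrix p * conjMatrix q
    simp only [conjMatrix_eq]
    rw [Metric.unitSphere.coe_mul, Quaternion.re_mul, Quaternion.imI_mul, Quaternion.imJ_mul,
      Quaternion.imK_mul]
    ext i j
    fin_cases i <;> fin_cases j <;> simp [Matrix.mul_apply, Fin.sum_univ_three] <;> ring

/-- The matrix entry `(i, j)` as a function on `SO(3)`. -/
def SO3.entry (i j : Fin 3) (S : SO3) : ℝ := S.1 i j

theorem SO3.leftTranslate_mem (R : SO3) (u : TangentSpace (𝓡 3) R) :
    R.1ᵀ * Matrix.of (fun i j => mvfderiv (𝓡 3) (SO3.entry i j) R u) ∈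
      LieAlgebra.Orthogonal.so (Fin 3) ℝ := by
  have hd : ∀ i j, MDifferentiableAt (𝓡 3) 𝓘(ℝ, ℝ) (SO3.entry i j) R := fun i j =>
    (SO3.contMDiff_entry i j).mdifferentiable (by simp) R
  have hm : ∀ k i j, MDifferentiableAt (𝓡 3) 𝓘(ℝ, ℝ) (SO3.entry k i * SO3.entry k j) R :=
    fun k i j => (hd k i).mul (hd k j)
  have key : ∀ i j, SO3.entry 0 i * SO3.entry 0 j + SO3.entry 1 i * SO3.entry 1 j +
      SO3.entry 2 i * SO3.entry 2 j = fun _ : SO3 => (1 : Matrix (Fin 3) (Fin 3) ℝ) i j := by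
    intro i j
    funext S
    rw [← SO3.transpose_mul S]
    simp [SO3.entry, Matrix.mul_apply, Fin.sum_univ_three]
  rw [LieAlgebra.Orthogonal.mem_so]
  ext i j
  have h := congrArg (fun f => mvfderiv (𝓡 3) f R u) (key j i)
  beta_reduce at h
  rw [mvfderiv_const, mvfderiv_add ((hm 0 j i).add (hm 1 j i)) (hm 2 j i),
    mvfderiv_add (hm 0 j i) (hm 1 j i), mvfderiv_mul (hd 0 j) (hd 0 i),
    mvfderiv_mul (hd 1 j) (hd 1 i), mvfderiv_mul (hd 2 j) (hd 2 i)] at h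
  simp [Matrix.mul_apply, Fin.sum_univ_three] at h ⊢
  simp only [SO3.entry] at h
  linarith

/-- The round metric: the inner product of `ℍ = ℝ⁴` restricted to the tangent spaces of `S³` by the
differential of the inclusion. -/
def roundMetric (q : S3) (u v : TangentSpace (𝓡 3) q) : ℝ :=
  inner ℝ (mvfderiv (𝓡 3) (fun p : S3 => (p : ℍ[ℝ])) q u)
    (mvfderiv (𝓡 3) (fun p : S3 => (p : ℍ[ℝ])) q v)

/-- The left translate `R⁻¹ u ∈ T_1 SO(3) = 𝔰𝔬(3)` of a tangent vector `u` of `SO(3)` at `R`: the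
matrix `Rᵀ · dι(u)`, with `ι` the inclusion of `SO(3)` into the matrices. -/
def SO3.leftTranslate (R : SO3) (u : TangentSpace (𝓡 3) R) : LieAlgebra.Orthogonal.so (Fin 3) ℝ :=
  ⟨R.1ᵀ * Matrix.of (fun i j => mvfderiv (𝓡 3) (SO3.entry i j) R u),
    SO3.leftTranslate_mem R u⟩

/-- The left-invariant metric on `SO(3)` whose value at `1` is `-κ / 8`, with `κ` the Killing form of
the Lie algebra `𝔰𝔬(3)` of skew-symmetric matrices. -/
def g8 (R : SO3) (u v : TangentSpace (𝓡 3) R) : ℝ :=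
  -(1 / 8) * killingForm ℝ (LieAlgebra.Orthogonal.so (Fin 3) ℝ)
    (SO3.leftTranslate R u) (SO3.leftTranslate R v)

section Riemannian

/-- Smooth Riemannian metrics on a manifold. -/
abbrev SmoothRiemannianMetric (M : Type*) [TopologicalSpace M] [ChartedSpace E3 M]
    [IsManifold (𝓡 3) ∞ M] : Type _ :=
  Bundle.ContMDiffRiemannianMetric (𝓡 3) ∞ E3 (fun x : M => TangentSpace (𝓡 3) x)

variable {M N : Type*} [TopologicalSpace M] [ChartedSpace E3 M] [IsManifold (𝓡 3) ∞ M]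
  [TopologicalSpace N] [ChartedSpace E3 N] [IsManifold (𝓡 3) ∞ N]

/-- `π` is a smooth submersion whose differential at each `x` restricts to a linear isometry from
the horizontal space (the `gM`-orthogonal complement of the kernel of the differential) to the
tangent space of `N` at `π x`. -/
def IsRiemannianSubmersion
    (gM : ∀ x : M, TangentSpace (𝓡 3) x → TangentSpace (𝓡 3) x → ℝ)
    (gN : SmoothRiemannianMetric N) (π : M → N) : Prop :=
  ContMDiff (𝓡 3) (𝓡 3) ∞ π ∧ ∀ x : M,
    Function.Surjective (mfderiv (𝓡 3) (𝓡 3) π x) ∧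
    ∀ u v : TangentSpace (𝓡 3) x,
      (∀ w : TangentSpace (𝓡 3) x, mfderiv (𝓡 3) (𝓡 3) π x w = 0 → gM x u w = 0) →
      (∀ w : TangentSpace (𝓡 3) x, mfderiv (𝓡 3) (𝓡 3) π x w = 0 → gM x v w = 0) →
      gN.inner (π x) (mfderiv (𝓡 3) (𝓡 3) π x u) (mfderiv (𝓡 3) (𝓡 3) π x v) = gM x u v

/-- The diffeomorphism `φ` is an isometry of Riemannian manifolds. -/
def IsIsometry (gM : SmoothRiemannianMetric M) (gN : SmoothRiemannianMetric N)
    (φ : Diffeomorph (𝓡 3) (𝓡 3) M N ∞) : Prop :=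
  ∀ (x : M) (u v : TangentSpace (𝓡 3) x),
    gN.inner (φ x) (mfderiv (𝓡 3) (𝓡 3) φ x u) (mfderiv (𝓡 3) (𝓡 3) φ x v) = gM.inner x u v

end Riemannian

end

end RealFlag

open RealFlag

/-! Both metrics upstairs are pullbacks of a Euclidean inner product by an immersion `F : G → V`:
the inclusion of `S3` in `ℍ`, and the inclusion of `SO3` in the matrices divided by `√8`. In both
cases right multiplication by an element of the finite group `K` acts on `F` through a linear
isometry of `V`. Two lifts to `G` of one map into `G ⧸ K` differ locally by a constant of `K`, so
the pullback of the inner product by `F ∘ σ` does not depend on the local section `σ`. These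
pullbacks glue to a smooth metric (`exists_quotientMetric`). The projection is a local
diffeomorphism, so every vector is horizontal, a Riemannian submersion is a local isometry, and
uniqueness follows.

The comparison of the two sides is `g8_mfderiv_doubleCover`: the Killing form of `𝔰𝔬(3)` is `tr
(XY)`, which makes `g8` the Frobenius product divided by 8, and differentiating `q u q⁻¹` shows that
`B` pulls it back to the round metric. Finally `B` is onto, has smooth local sections, and satisfies
`B⁻¹(T) = Q₈`, so it descends to a diffeomorphism, which inherits the isometry property. -/

namespace RealFlag

/-! ### Smoothness of a pulled-back inner product -/

section Metric
variable {V : Type*} [NormedAddCommGroup V] [InnerProductSpace ℝ V]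
  {N : Type*} [TopologicalSpace N] [ChartedSpace E3 N] [IsManifold (𝓡 3) ∞ N]

/-- In the trivialization at `p₀` the form is `⟪D p ·, D p ·⟫`, with `D p` the differential of `F`
in coordinates. `D` is smooth in `p`, and `L ↦ ⟪L ·, L ·⟫` is smooth on linear maps. Only the
behaviour near `p₀` matters, so `F` may come from a local section. -/
theorem contMDiffAt_bilinear_of_eventually_inner_mvfderiv
    (g : ∀ p : N, TangentSpace (𝓡 3) p →L[ℝ] TangentSpace (𝓡 3) p →L[ℝ] ℝ)
    {F : N → V} {p₀ : N} (hF : ContMDiffAt (𝓡 3) 𝓘(ℝ, V) ∞ F p₀)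
    (hg : ∀ᶠ p in nhds p₀, ∀ u v : TangentSpace (𝓡 3) p,
      g p u v = inner ℝ (mvfderiv (𝓡 3) F p u) (mvfderiv (𝓡 3) F p v)) :
    ContMDiffAt (𝓡 3) ((𝓡 3).prod 𝓘(ℝ, E3 →L[ℝ] E3 →L[ℝ] ℝ)) ∞
      (fun p => Bundle.TotalSpace.mk' (E3 →L[ℝ] E3 →L[ℝ] ℝ)
        (E := fun p : N => TangentSpace (𝓡 3) p →L[ℝ] TangentSpace (𝓡 3) p →L[ℝ] ℝ) p (g p)) p₀ := by
  rw [contMDiffAt_hom_bundle]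
  refine ⟨contMDiffAt_id, ?_⟩
  have hD := hF.mfderiv_const (m := ∞) le_rfl
  set D := inTangentCoordinates (𝓡 3) 𝓘(ℝ, V) id F (mfderiv (𝓡 3) 𝓘(ℝ, V) F) p₀ with hDdef
  let B : V →L[ℝ] V →L[ℝ] ℝ := (isBoundedBilinearMap_inner (𝕜 := ℝ) (E := V)).toContinuousLinearMap
  have hsm : ContMDiffAt (𝓡 3) 𝓘(ℝ, E3 →L[ℝ] E3 →L[ℝ] ℝ) ∞
      (fun p => B.bilinearComp (D p) (D p)) p₀ := by
    have h : ContDiff ℝ ∞ fun L : E3 →L[ℝ] V => B.bilinearComp L L := by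
      refine contDiff_clm_apply_iff.2 fun v => contDiff_clm_apply_iff.2 fun w => ?_
      exact (contDiff_id.clm_apply contDiff_const).inner ℝ (contDiff_id.clm_apply contDiff_const)
    exact h.contMDiff.contMDiffAt.comp p₀ hD
  refine hsm.congr_of_eventuallyEq ?_
  have hb := (trivializationAt E3 (TangentSpace (𝓡 3) : N → Type _) p₀).open_baseSet.mem_nhds
    (FiberBundle.mem_baseSet_trivializationAt' p₀)
  filter_upwards [hg, hb] with p hp hpb
  ext v w
  rw [inCoordinates_apply_eq₂ hpb hpb (Set.mem_univ _)]
  have hDa : ∀ x : E3, D p x = mvfderiv (𝓡 3) F p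
      ((trivializationAt E3 (TangentSpace (𝓡 3) : N → Type _) p₀).symm p x) := by
    intro x
    rw [← Bundle.Trivialization.symmL_apply (R := ℝ) _ hpb]
    simp [hDdef, inTangentCoordinates, ContinuousLinearMap.inCoordinates]
    rfl
  simp [B, hp, hDa]
end Metric

/-! ### The projection onto a quotient by a finite subgroup -/

section LocalDiffeomorph
variable {E G : Type*} [NormedAddCommGroup E] [NormedSpace ℝ E]
  [TopologicalSpace G] [T2Space G] [Group G] [IsTopologicalGroup G]
  [ChartedSpace E G] [LieGroup 𝓘(ℝ, E) ∞ G]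

/-- Right translation of a Lie group. -/
noncomputable def mulRightDiffeomorph (k : G) : Diffeomorph 𝓘(ℝ, E) 𝓘(ℝ, E) G G ∞ where
  toEquiv := Equiv.mulRight k
  contMDiff_toFun := contMDiff_mul_right
  contMDiff_invFun := contMDiff_mul_right

/-- The chart at `p` is a local inverse of the projection at a chosen representative `a`, followed
by the chart at `a`; near `a` the projection is therefore the identity in charts. Any other point of
the fibre is `a * k`, and right translation by `k⁻¹`, which the projection does not see, carries it
to `a`. -/
theorem isLocalDiffeomorph_mk (K : Subgroup G) [Finite K] :
    IsLocalDiffeomorph 𝓘(ℝ, E) 𝓘(ℝ, E) ∞ (QuotientGroup.mk : G → G ⧸ K) := by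
  have : IsManifold 𝓘(ℝ, E) ∞ G := inferInstance
  intro q
  have hl := isLocalHomeomorph_mk K
  let p : G ⧸ K := QuotientGroup.mk q
  let a : G := (QuotientGroup.mk_surjective (s := K)).hasRightInverse.choose p
  have ha : (QuotientGroup.mk a : G ⧸ K) = p :=
    (QuotientGroup.mk_surjective (s := K)).hasRightInverse.choose_spec p
  have hchart : chartAt E p = (hl.localInverseAt a).trans (chartAt E a) := rfl
  have hat : IsLocalDiffeomorphAt 𝓘(ℝ, E) 𝓘(ℝ, E) ∞ (QuotientGroup.mk : G → G ⧸ K) a := by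
    let Ψ : PartialDiffeomorph 𝓘(ℝ, E) 𝓘(ℝ, E) G (G ⧸ K) ∞ :=
      { toPartialEquiv := ((chartAt E a).trans (chartAt E p).symm).toPartialEquiv
        open_source := ((chartAt E a).trans (chartAt E p).symm).open_source
        open_target := ((chartAt E a).trans (chartAt E p).symm).open_target
        contMDiffOn_toFun := (contMDiffOn_chart_symm (x := p)).comp
          ((contMDiffOn_chart (x := a)).mono Set.inter_subset_left) Set.inter_subset_right
        contMDiffOn_invFun := (contMDiffOn_chart_symm (x := a)).comp
          ((contMDiffOn_chart (x := p)).mono Set.inter_subset_left) Set.inter_subset_right }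
    refine ⟨Ψ, ⟨mem_chart_source E a, ?_⟩, ?_⟩
    · have h : chartAt E a a = chartAt E p p := by
        rw [hchart, ← ha]
        simp
      change chartAt E a a ∈ (chartAt E p).target
      rw [h]
      exact (chartAt E p).map_source (mem_chart_source E p)
    · intro x hx
      change _ = (chartAt E p).symm (chartAt E a x)
      rw [hchart, OpenPartialHomeomorph.coe_trans_symm, Function.comp_apply,
        (chartAt E a).left_inv hx.1, IsLocalHomeomorph.localInverseAt_symm]
  obtain ⟨k, hk⟩ : ∃ k : K, q = a * k := ⟨⟨a⁻¹ * q, QuotientGroup.eq.1 ha⟩, by simp⟩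
  rw [hk]
  have hr := ((mulRightDiffeomorph (E := E) (k⁻¹ : G)).isLocalDiffeomorph (a * k))
  have hmul : mulRightDiffeomorph (E := E) (k⁻¹ : G) (a * k) = a := mul_inv_cancel_right a (k : G)
  have hat' : IsLocalDiffeomorphAt 𝓘(ℝ, E) 𝓘(ℝ, E) ∞ (QuotientGroup.mk : G → G ⧸ K)
      (mulRightDiffeomorph (E := E) (k⁻¹ : G) (a * k)) := by
    rw [hmul]
    exact hat
  have hc := hr.comp 𝓘(ℝ, E) (G ⧸ K) hat'
  convert hc using 1
  funext x
  exact (QuotientGroup.mk_mul_of_mem x (inv_mem k.2)).symm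

theorem exists_section_mk (K : Subgroup G) [Finite K] (p : G ⧸ K) :
    ∃ σ : G ⧸ K → G, ∀ᶠ y in nhds p,
      ContMDiffAt 𝓘(ℝ, E) 𝓘(ℝ, E) ∞ σ y ∧ (QuotientGroup.mk (σ y) : G ⧸ K) = y := by
  obtain ⟨q, rfl⟩ := QuotientGroup.mk_surjective p
  have h := isLocalDiffeomorph_mk (E := E) K q
  refine ⟨h.localInverse, ?_⟩
  have hn := h.localInverse_open_source.mem_nhds h.localInverse_mem_source
  filter_upwards [hn] with y hy
  exact ⟨h.localInverse_contMDiffOn.contMDiffAt (h.localInverse_open_source.mem_nhds hy),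
    h.localInverse_right_inv hy⟩

theorem contMDiffAt_of_comp_mk (K : Subgroup G) [Finite K] {E' H' M : Type*}
    [NormedAddCommGroup E'] [NormedSpace ℝ E'] [TopologicalSpace H'] {I' : ModelWithCorners ℝ E' H'}
    [TopologicalSpace M] [ChartedSpace H' M] {f : G ⧸ K → M} {q : G}
    (hf : ContMDiffAt 𝓘(ℝ, E) I' ∞ (fun x : G => f x) q) :
    ContMDiffAt 𝓘(ℝ, E) I' ∞ f (q : G ⧸ K) := by
  have h := isLocalDiffeomorph_mk (E := E) K q
  have hq : h.localInverse (q : G ⧸ K) = q := h.localInverse_left_inv h.localInverse_mem_target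
  have hc := ContMDiffAt.comp_of_eq hf h.localInverse_contMDiffAt hq
  refine hc.congr_of_eventuallyEq ?_
  filter_upwards [h.localInverse_eventuallyEq_right] with y hy
  exact congrArg f hy.symm

end LocalDiffeomorph

/-- The quotient `(h y)⁻¹ * f y` is continuous at `x` and takes values in the finite set `K` near
`x`, hence is locally constant. -/
theorem eventually_eq_mul_of_mk_eq {G X : Type*} [TopologicalSpace G] [T2Space G] [Group G]
    [IsTopologicalGroup G] (K : Subgroup G) [Finite K] [TopologicalSpace X] {x : X} {f h : X → G}
    (hf : ContinuousAt f x) (hh : ContinuousAt h x)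
    (he : ∀ᶠ y in nhds x, (f y : G ⧸ K) = h y) :
    ∃ k ∈ K, ∀ᶠ y in nhds x, f y = h y * k := by
  refine ⟨(h x)⁻¹ * f x, QuotientGroup.eq.1 he.self_of_nhds.symm, ?_⟩
  have hc : ContinuousAt (fun y => (h y)⁻¹ * f y) x := hh.inv.mul hf
  -- The other elements of `K` form a finite, hence closed, set that misses the value at `x`.
  have hfin : ((K : Set G) \ {(h x)⁻¹ * f x}).Finite := (K : Set G).toFinite.subset Set.sdiff_subset
  have hn := hc.preimage_mem_nhds (hfin.isClosed.isOpen_compl.mem_nhds (by simp))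
  filter_upwards [he, hn] with y hy hy'
  have hmem : (h y)⁻¹ * f y ∈ K := QuotientGroup.eq.1 hy.symm
  have : (h y)⁻¹ * f y = (h x)⁻¹ * f x := by
    by_contra hne
    exact hy' ⟨hmem, hne⟩
  rw [← this, mul_inv_cancel_left]

/-! ### Descent of the metric to the quotient -/

section Descent
variable {V : Type*} [NormedAddCommGroup V] [InnerProductSpace ℝ V]
  {G : Type*} [TopologicalSpace G] [T2Space G] [Group G] [IsTopologicalGroup G]
  [ChartedSpace E3 G]

/-- Locally `f = h * k` with `k` constant, so `F ∘ f = A ∘ F ∘ h` with `A` a linear isometry, which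
drops out of the inner product. This is the independence of the lift. -/
theorem inner_mvfderiv_comp_eq_of_mk_eq (K : Subgroup G) [Finite K] {F : G → V}
    (hF : ContMDiff (𝓡 3) 𝓘(ℝ, V) ∞ F)
    (hK : ∀ k ∈ K, ∃ A : V →ₗᵢ[ℝ] V, ∀ q, F (q * k) = A (F q))
    {X : Type*} [TopologicalSpace X] [ChartedSpace E3 X] {x : X} {f h : X → G}
    (hf : ContinuousAt f x) (hh : MDifferentiableAt (𝓡 3) (𝓡 3) h x)
    (he : ∀ᶠ y in nhds x, (f y : G ⧸ K) = h y) (u v : TangentSpace (𝓡 3) x) :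
    inner ℝ (mvfderiv (𝓡 3) (F ∘ f) x u) (mvfderiv (𝓡 3) (F ∘ f) x v) =
      inner ℝ (mvfderiv (𝓡 3) (F ∘ h) x u) (mvfderiv (𝓡 3) (F ∘ h) x v) := by
  obtain ⟨k, hk, hfk⟩ := eventually_eq_mul_of_mk_eq K hf hh.continuousAt he
  obtain ⟨A, hA⟩ := hK k hk
  have hev : F ∘ f =ᶠ[nhds x] A ∘ (F ∘ h) := by
    filter_upwards [hfk] with y hy
    simp [hy, hA]
  have hFh : MDifferentiableAt (𝓡 3) 𝓘(ℝ, V) (F ∘ h) x :=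
    (hF.mdifferentiable (by simp) _).comp x hh
  have hd : ∀ w : TangentSpace (𝓡 3) x,
      mvfderiv (𝓡 3) (F ∘ f) x w = A (mvfderiv (𝓡 3) (F ∘ h) x w) := by
    intro w
    have h1 : mfderiv (𝓡 3) 𝓘(ℝ, V) (F ∘ f) x = mfderiv (𝓡 3) 𝓘(ℝ, V) (A ∘ (F ∘ h)) x :=
      hev.mfderiv_eq
    have h2 := mfderiv_comp_apply x
      (A.toContinuousLinearMap.contMDiff (n := ∞).mdifferentiable (by simp) _) hFh w
    have h3 : mfderiv 𝓘(ℝ, V) 𝓘(ℝ, V) A ((F ∘ h) x) = A.toContinuousLinearMap := by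
      rw [mfderiv_eq_fderiv]
      exact A.toContinuousLinearMap.fderiv
    change mfderiv (𝓡 3) 𝓘(ℝ, V) (F ∘ f) x w = A (mfderiv (𝓡 3) 𝓘(ℝ, V) (F ∘ h) x w)
    rw [h1]
    refine h2.trans ?_
    exact congrArg (fun L => L (mfderiv (𝓡 3) 𝓘(ℝ, V) (F ∘ h) x w)) h3
  rw [hd, hd, A.inner_map_map]

variable [LieGroup (𝓡 3) ∞ G]

theorem inner_mvfderiv_section (K : Subgroup G) [Finite K] {F : G → V}
    (hF : ContMDiff (𝓡 3) 𝓘(ℝ, V) ∞ F)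
    (hK : ∀ k ∈ K, ∃ A : V →ₗᵢ[ℝ] V, ∀ q, F (q * k) = A (F q)) {σ : G ⧸ K → G} {q : G}
    (hσ : MDifferentiableAt (𝓡 3) (𝓡 3) σ (q : G ⧸ K))
    (hs : ∀ᶠ y in nhds (q : G ⧸ K), (σ y : G ⧸ K) = y) (u v : TangentSpace (𝓡 3) q) :
    inner ℝ (mvfderiv (𝓡 3) (F ∘ σ) (q : G ⧸ K) (mfderiv (𝓡 3) (𝓡 3) (QuotientGroup.mk : G → G ⧸ K) q u))
        (mvfderiv (𝓡 3) (F ∘ σ) (q : G ⧸ K) (mfderiv (𝓡 3) (𝓡 3) (QuotientGroup.mk : G → G ⧸ K) q v)) =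
      inner ℝ (mvfderiv (𝓡 3) F q u) (mvfderiv (𝓡 3) F q v) := by
  have hπ : MDifferentiableAt (𝓡 3) (𝓡 3) (QuotientGroup.mk : G → G ⧸ K) q :=
    (isLocalDiffeomorph_mk (E := E3) K q).mdifferentiableAt (by simp)
  have hd : MDifferentiableAt (𝓡 3) 𝓘(ℝ, V) (F ∘ σ) (q : G ⧸ K) :=
    (hF.mdifferentiable (by simp) _).comp _ hσ
  have hc : ∀ w : TangentSpace (𝓡 3) q, mvfderiv (𝓡 3) (F ∘ σ) (q : G ⧸ K)
      (mfderiv (𝓡 3) (𝓡 3) (QuotientGroup.mk : G → G ⧸ K) q w) =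
      mvfderiv (𝓡 3) (F ∘ (σ ∘ (QuotientGroup.mk : G → G ⧸ K))) q w :=
    fun w => (mfderiv_comp_apply q hd hπ w).symm
  rw [hc, hc]
  -- `σ ∘ mk` and the identity are two lifts of the projection itself.
  exact inner_mvfderiv_comp_eq_of_mk_eq K hF hK (f := σ ∘ (QuotientGroup.mk : G → G ⧸ K)) (h := id)
    (hσ.continuousAt.comp hπ.continuousAt) mdifferentiableAt_id
    (hπ.continuousAt.eventually hs) u v

theorem exists_quotientMetric (K : Subgroup G) [Finite K] {F : G → V}
    (hF : ContMDiff (𝓡 3) 𝓘(ℝ, V) ∞ F) (hi : ∀ q, Function.Injective (mvfderiv (𝓡 3) F q))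
    (hK : ∀ k ∈ K, ∃ A : V →ₗᵢ[ℝ] V, ∀ q, F (q * k) = A (F q)) :
    ∃ g : SmoothRiemannianMetric (G ⧸ K), ∀ (q : G) (u v : TangentSpace (𝓡 3) q),
      g.inner (q : G ⧸ K) (mfderiv (𝓡 3) (𝓡 3) (QuotientGroup.mk : G → G ⧸ K) q u)
        (mfderiv (𝓡 3) (𝓡 3) (QuotientGroup.mk : G → G ⧸ K) q v) =
      inner ℝ (mvfderiv (𝓡 3) F q u) (mvfderiv (𝓡 3) F q v) := by
  choose σ hσ using fun p : G ⧸ K => exists_section_mk (E := E3) K p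
  have hσd : ∀ p, MDifferentiableAt (𝓡 3) (𝓡 3) (σ p) p := fun p =>
    (hσ p).self_of_nhds.1.mdifferentiableAt (by simp)
  let L : ∀ p : G ⧸ K, TangentSpace (𝓡 3) p →L[ℝ] V := fun p => mvfderiv (𝓡 3) (F ∘ σ p) p
  let B : V →L[ℝ] V →L[ℝ] ℝ := (isBoundedBilinearMap_inner (𝕜 := ℝ) (E := V)).toContinuousLinearMap
  let gi : ∀ p : G ⧸ K, TangentSpace (𝓡 3) p →L[ℝ] TangentSpace (𝓡 3) p →L[ℝ] ℝ := fun p =>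
    (B.bilinearComp (L p : E3 →L[ℝ] V) (L p : E3 →L[ℝ] V) : E3 →L[ℝ] E3 →L[ℝ] ℝ)
  -- A vector downstairs is the image of some `w`, and its image under `L` has the norm of `dF w`;
  -- injectivity of `dF` passes to `L`.
  have hLi : ∀ p, Function.Injective (L p) := by
    intro p
    obtain ⟨q, rfl⟩ := QuotientGroup.mk_surjective p
    refine (injective_iff_map_eq_zero _).2 fun v hv => ?_
    obtain ⟨w, rfl⟩ := ((isLocalDiffeomorph_mk (E := E3) K q).mfderivToContinuousLinearEquiv
      (by simp)).surjective v
    have h := inner_mvfderiv_section K hF hK (hσd q) ((hσ q).mono fun _ h => h.2) w w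
    rw [show mvfderiv (𝓡 3) (F ∘ σ q) (q : G ⧸ K)
      (mfderiv (𝓡 3) (𝓡 3) (QuotientGroup.mk : G → G ⧸ K) q w) = 0 from hv, inner_zero_left,
      eq_comm, inner_self_eq_zero] at h
    rw [(injective_iff_map_eq_zero _).1 (hi q) w h, map_zero]
  refine ⟨{
    inner := gi
    symm := fun p v w => real_inner_comm _ _
    pos := fun p v hv => real_inner_self_pos.2 fun h => hv ((injective_iff_map_eq_zero _).1 (hLi p) v h)
    isVonNBounded := ?_
    contMDiff := ?_ }, fun q u v => ?_⟩
  · intro p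
    let L' : E3 →L[ℝ] V := L p
    -- An injective linear map on a finite-dimensional space is bounded below, so the unit ball of
    -- the form lies in a ball of radius `C`.
    obtain ⟨C, hC0, hC⟩ := L'.toLinearMap.exists_antilipschitzWith (LinearMap.ker_eq_bot.2 (hLi p))
    change Bornology.IsVonNBounded ℝ {v : E3 | inner ℝ (L' v) (L' v) < 1}
    refine (NormedSpace.isVonNBounded_closedBall ℝ E3 C).subset fun v hv => ?_
    have h1 : ‖L' v‖ ≤ 1 := by
      have : inner ℝ (L' v) (L' v) < 1 := hv
      rw [real_inner_self_eq_norm_sq] at this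
      nlinarith [norm_nonneg (L' v)]
    rw [mem_closedBall_zero_iff]
    calc ‖v‖ ≤ C * ‖L' v‖ := by simpa using hC.le_mul_norm_sub (x := v) (y := 0)
      _ ≤ C * 1 := by gcongr
      _ = C := mul_one _
  · intro p₀
    -- The form at `p` is defined by the section `σ p`, which varies with `p` without any
    -- continuity. Near `p₀` the single section `σ p₀` gives the same form, being another lift of
    -- the identity.
    refine contMDiffAt_bilinear_of_eventually_inner_mvfderiv _ (F := F ∘ σ p₀)
      (hF.contMDiffAt.comp p₀ (hσ p₀).self_of_nhds.1) ?_
    filter_upwards [hσ p₀, (hσ p₀).eventually_nhds] with p hp hp' u v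
    refine inner_mvfderiv_comp_eq_of_mk_eq K hF hK (hσd p).continuousAt
      (hp.1.mdifferentiableAt (by simp)) ?_ u v
    filter_upwards [hσ p, hp'] with y h1 h2
    rw [h1.2, h2.2]
  · exact inner_mvfderiv_section K hF hK (hσd q) ((hσ q).mono fun _ h => h.2) u v

/-- The differential of the projection is bijective, so its kernel is zero and horizontality is no
condition. Since `gM` is a bare function, `h0` has to supply its vanishing on the zero vector. -/
theorem isRiemannianSubmersion_mk_iff (K : Subgroup G) [Finite K]
    {gM : ∀ q : G, TangentSpace (𝓡 3) q → TangentSpace (𝓡 3) q → ℝ} (h0 : ∀ q u, gM q u 0 = 0)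
    (g : SmoothRiemannianMetric (G ⧸ K)) :
    IsRiemannianSubmersion gM g (fun q : G => (q : G ⧸ K)) ↔
      ∀ (q : G) (u v : TangentSpace (𝓡 3) q),
        g.inner (q : G ⧸ K) (mfderiv (𝓡 3) (𝓡 3) (QuotientGroup.mk : G → G ⧸ K) q u)
          (mfderiv (𝓡 3) (𝓡 3) (QuotientGroup.mk : G → G ⧸ K) q v) = gM q u v := by
  have hl := isLocalDiffeomorph_mk (E := E3) K
  have hb := fun q => (hl.mfderivToContinuousLinearEquiv (by simp) q).bijective
  constructor
  · rintro ⟨-, h⟩ q u v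
    have hz : ∀ u w : TangentSpace (𝓡 3) q,
        mfderiv (𝓡 3) (𝓡 3) (fun q : G => (q : G ⧸ K)) q w = 0 → gM q u w = 0 := by
      intro u w hw
      rw [(hb q).1 (hw.trans (map_zero _).symm), h0]
    exact (h q).2 u v (hz u) (hz v)
  · intro h
    exact ⟨hl.contMDiff, fun q => ⟨(hb q).2, fun u v _ _ => h q u v⟩⟩

theorem existsUnique_isRiemannianSubmersion_mk (K : Subgroup G) [Finite K] {F : G → V}
    (hF : ContMDiff (𝓡 3) 𝓘(ℝ, V) ∞ F) (hi : ∀ q, Function.Injective (mvfderiv (𝓡 3) F q))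
    (hK : ∀ k ∈ K, ∃ A : V →ₗᵢ[ℝ] V, ∀ q, F (q * k) = A (F q))
    {gM : ∀ q : G, TangentSpace (𝓡 3) q → TangentSpace (𝓡 3) q → ℝ}
    (hg : ∀ q u v, gM q u v = inner ℝ (mvfderiv (𝓡 3) F q u) (mvfderiv (𝓡 3) F q v)) :
    ∃ g₀ : SmoothRiemannianMetric (G ⧸ K), ∀ g : SmoothRiemannianMetric (G ⧸ K),
      IsRiemannianSubmersion gM g (fun q : G => (q : G ⧸ K)) ↔ g = g₀ := by
  have h0 : ∀ q u, gM q u 0 = 0 := fun q u => by rw [hg, map_zero, inner_zero_right]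
  obtain ⟨g₀, hg₀⟩ := exists_quotientMetric K hF hi hK
  refine ⟨g₀, fun g => ?_⟩
  rw [isRiemannianSubmersion_mk_iff K h0]
  constructor
  · intro h
    have : g.inner = g₀.inner := by
      funext p
      obtain ⟨q, rfl⟩ := QuotientGroup.mk_surjective p
      have hs := ((isLocalDiffeomorph_mk (E := E3) K).mfderivToContinuousLinearEquiv
        (by simp) q).surjective
      ext u v
      obtain ⟨u, rfl⟩ := hs u
      obtain ⟨v, rfl⟩ := hs v
      exact (h q u v).trans ((hg q u v).trans (hg₀ q u v).symm)
    cases g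
    cases g₀
    congr
  · rintro rfl q u v
    rw [hg₀, hg]

end Descent

/-! ### The Killing form of `𝔰𝔬(3)` and `g8` as a Euclidean pullback -/

theorem mvfderiv_clm_comp {V W X : Type*} [NormedAddCommGroup V] [NormedSpace ℝ V]
    [NormedAddCommGroup W] [NormedSpace ℝ W] [TopologicalSpace X] [ChartedSpace E3 X] {x : X}
    (A : V →L[ℝ] W) {F : X → V} (hF : MDifferentiableAt (𝓡 3) 𝓘(ℝ, V) F x)
    (u : TangentSpace (𝓡 3) x) :
    mvfderiv (𝓡 3) (fun y => A (F y)) x u = A (mvfderiv (𝓡 3) F x u) := by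
  have h := mfderiv_comp_apply x (A.contMDiff (n := ∞).mdifferentiable (by simp) (F x)) hF u
  rw [mfderiv_eq_fderiv, A.fderiv] at h
  exact h

/-- The linear isomorphism between skew-symmetric `3 × 3` matrices and vectors. -/
noncomputable def soEquiv : LieAlgebra.Orthogonal.so (Fin 3) ℝ ≃ₗ[ℝ] (Fin 3 → ℝ) where
  toFun X := ![X.1 2 1, X.1 0 2, X.1 1 0]
  invFun x := ⟨!![0, -x 2, x 1; x 2, 0, -x 0; -x 1, x 0, 0], by
    rw [LieAlgebra.Orthogonal.mem_so]
    ext i j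
    fin_cases i <;> fin_cases j <;> simp⟩
  map_add' X Y := by
    ext i
    fin_cases i <;> simp
  map_smul' c X := by
    ext i
    fin_cases i <;> simp
  left_inv X := by
    have h := (LieAlgebra.Orthogonal.mem_so _ _ _).1 X.2
    have e (i j) : X.1 j i = -X.1 i j := congrFun (congrFun h i) j
    refine Subtype.ext ?_
    ext i j
    have e00 := e 0 0
    have e11 := e 1 1
    have e22 := e 2 2
    have e01 := e 0 1
    have e02 := e 0 2
    have e12 := e 1 2
    fin_cases i <;> fin_cases j <;> simp <;> linarith
  right_inv x := by
    ext i
    fin_cases i <;> simp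

/-- Under `soEquiv` the bracket is the cross product and `X` is the matrix of `x × ·`, so `ad X` has
matrix `X` itself in this basis. -/
theorem killingForm_so_three (X Y : LieAlgebra.Orthogonal.so (Fin 3) ℝ) :
    killingForm ℝ (LieAlgebra.Orthogonal.so (Fin 3) ℝ) X Y = (X.1 * Y.1).trace := by
  obtain ⟨x, rfl⟩ := soEquiv.symm.surjective X
  obtain ⟨y, rfl⟩ := soEquiv.symm.surjective Y
  rw [killingForm_apply_apply, LinearMap.trace_eq_matrix_trace ℝ (Module.Basis.ofEquivFun soEquiv),
    Matrix.trace_fin_three, Matrix.trace_fin_three]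
  simp only [LinearMap.toMatrix_apply, Module.Basis.ofEquivFun_repr_apply,
    Module.Basis.coe_ofEquivFun, LinearMap.comp_apply, LieAlgebra.ad_apply]
  simp [soEquiv, Ring.lie_def, Matrix.mul_apply, Fin.sum_univ_three]
  ring

/-- The rescaled embedding of `SO(3)` into the Euclidean space of matrices. -/
noncomputable def SO3.embed (S : SO3) : EuclideanSpace ℝ (Fin 3 × Fin 3) :=
  WithLp.toLp 2 fun p => (√8)⁻¹ * SO3.entry p.1 p.2 S

theorem SO3.contMDiff_embed :
    ContMDiff (𝓡 3) 𝓘(ℝ, EuclideanSpace ℝ (Fin 3 × Fin 3)) ∞ SO3.embed := by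
  have h : ContMDiff (𝓡 3) 𝓘(ℝ, Fin 3 × Fin 3 → ℝ) ∞
      fun S : SO3 => fun p : Fin 3 × Fin 3 => (√8)⁻¹ * SO3.entry p.1 p.2 S :=
    contMDiff_pi_space.2 fun p => contMDiff_const.mul (SO3.contMDiff_entry p.1 p.2)
  exact (EuclideanSpace.equiv (Fin 3 × Fin 3) ℝ).symm.contDiff.contMDiff.comp h

theorem SO3.mdifferentiable_entry (i j : Fin 3) :
    MDifferentiable (𝓡 3) 𝓘(ℝ, ℝ) (SO3.entry i j) :=
  (SO3.contMDiff_entry i j).mdifferentiable (by simp)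

theorem SO3.mvfderiv_embed_apply (R : SO3) (u : TangentSpace (𝓡 3) R) (i j : Fin 3) :
    mvfderiv (𝓡 3) SO3.embed R u (i, j) = (√8)⁻¹ * mvfderiv (𝓡 3) (SO3.entry i j) R u := by
  have h1 := mvfderiv_clm_comp (EuclideanSpace.proj (i, j) : EuclideanSpace ℝ (Fin 3 × Fin 3) →L[ℝ] ℝ)
    (SO3.contMDiff_embed.mdifferentiable (by simp) R) u
  have h2 := mvfderiv_clm_comp ((√8)⁻¹ • ContinuousLinearMap.id ℝ ℝ)
    (SO3.mdifferentiable_entry i j R) u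
  exact h1.symm.trans h2

/-- The chart at `R` factors through `SO3.embed`, as `invRodrigues` of a linear function of the
embedded matrix. A vector killed by the differential of the embedding is killed by that of the
chart, hence zero. -/
theorem SO3.mvfderiv_embed_injective (R : SO3) :
    Function.Injective (mvfderiv (𝓡 3) SO3.embed R) := by
  let M : EuclideanSpace ℝ (Fin 3 × Fin 3) → Matrix (Fin 3) (Fin 3) ℝ := fun w =>
    (R⁻¹).1 * Matrix.of fun i j => √8 * w (i, j)
  have hM : ∀ S, M (SO3.embed S) = (R⁻¹ * S).1 := by
    intro S
    refine congrArg (fun T => (R⁻¹).1 * T) (a₂ := S.1) ?_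
    ext i j
    simp [SO3.embed, SO3.entry]
  have hMd : ∀ i j, Differentiable ℝ fun w => M w i j := by
    intro i j
    simp only [M, Matrix.mul_apply, Matrix.of_apply, Fin.sum_univ_three]
    fun_prop
  have hΦ : DifferentiableAt ℝ (fun w => invRodrigues (M w)) (SO3.embed R) := by
    have ht : DifferentiableAt ℝ (fun w => (1 + (M w).trace)⁻¹) (SO3.embed R) := by
      refine DifferentiableAt.inv ?_ ?_
      · simp only [Matrix.trace_fin_three]
        exact (differentiableAt_const _).add ((((hMd 0 0) _).add ((hMd 1 1) _)).add ((hMd 2 2) _))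
      -- At `R` itself the matrix is `R⁻¹ * R = 1`, so the denominator is `1 + 3`.
      · rw [hM]
        simp
        norm_num
    rw [differentiableAt_euclidean]
    intro i
    fin_cases i <;> simp [invRodrigues] <;> exact ht.mul ((hMd _ _ _).sub (hMd _ _ _))
  refine (injective_iff_map_eq_zero _).2 fun u hu => ?_
  have hc : (fun S : SO3 => invRodrigues (M (SO3.embed S))) = chartAt E3 R := by
    funext S
    rw [hM]
    rfl
  have hd := mfderiv_comp_apply R hΦ.mdifferentiableAt
    (SO3.contMDiff_embed.mdifferentiable (by simp) R) u
  have hu' : mfderiv (𝓡 3) 𝓘(ℝ, EuclideanSpace ℝ (Fin 3 × Fin 3)) SO3.embed R u = 0 := hu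
  rw [hu', map_zero] at hd
  have hm : (chartAt E3 R).MDifferentiable (𝓡 3) 𝓘(ℝ, E3) :=
    mdifferentiable_chart R
  refine (injective_iff_map_eq_zero _).1 (hm.mfderiv_injective (mem_chart_source E3 R)) u ?_
  rw [← hc]
  exact hd

theorem inner_inv_sqrt_eight_mul (a b : ℝ) :
    inner ℝ ((√8)⁻¹ * a) ((√8)⁻¹ * b) = 1 / 8 * (a * b) := by
  have h : (√8)⁻¹ * (√8)⁻¹ = (1 / 8 : ℝ) := by
    rw [← mul_inv, Real.mul_self_sqrt (by norm_num)]
    norm_num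
  rw [← h]
  simp
  ring

/-- Tangency says that `RᵀA` is skew, so `RᵀA RᵀB = -AᵀR RᵀB = -AᵀB`, and `-κ / 8` becomes `tr (AᵀB)
/ 8`. The factor `(√8)⁻¹` in the embedding accounts for the `1 / 8`. -/
theorem g8_eq_inner (R : SO3) (u v : TangentSpace (𝓡 3) R) :
    g8 R u v = inner ℝ (mvfderiv (𝓡 3) SO3.embed R u) (mvfderiv (𝓡 3) SO3.embed R v) := by
  set A : Matrix (Fin 3) (Fin 3) ℝ := Matrix.of fun i j => mvfderiv (𝓡 3) (SO3.entry i j) R u with hA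
  set B : Matrix (Fin 3) (Fin 3) ℝ := Matrix.of fun i j => mvfderiv (𝓡 3) (SO3.entry i j) R v with hB
  have hs : R.1ᵀ * A = -(Aᵀ * R.1) := by
    have h := (LieAlgebra.Orthogonal.mem_so _ _ _).1 (SO3.leftTranslate_mem R u)
    rw [Matrix.transpose_mul, Matrix.transpose_transpose] at h
    rw [h, neg_neg]
  have h1 : (R.1ᵀ * A) * (R.1ᵀ * B) = -(Aᵀ * B) := by
    rw [hs, Matrix.neg_mul, Matrix.mul_assoc, ← Matrix.mul_assoc R.1, SO3.mul_transpose,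
      Matrix.one_mul]
  have h2 : g8 R u v = -(1 / 8) * ((R.1ᵀ * A) * (R.1ᵀ * B)).trace := by
    rw [g8, killingForm_so_three]
    rfl
  rw [h2, h1, PiLp.inner_apply, Fintype.sum_prod_type]
  simp only [SO3.mvfderiv_embed_apply, inner_inv_sqrt_eight_mul]
  simp [Matrix.trace_fin_three, Matrix.mul_apply, Fin.sum_univ_three, hA, hB]
  ring

/-- A diagonal orthogonal matrix has entries `±1`, and right multiplication by it changes the signs
of columns. -/
theorem SO3.embed_mul_diag (k : SO3) (hk : k ∈ diagTorus) :
    ∃ A : EuclideanSpace ℝ (Fin 3 × Fin 3) →ₗᵢ[ℝ] EuclideanSpace ℝ (Fin 3 × Fin 3),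
      ∀ S, SO3.embed (S * k) = A (SO3.embed S) := by
  have hk1 : ∀ j, k.1 j j ^ 2 = 1 := by
    intro j
    have h := congrFun (congrFun (SO3.mul_transpose k) j) j
    rw [Matrix.mul_apply, Finset.sum_eq_single j, Matrix.one_apply_eq] at h
    · rw [sq]
      exact h
    · intro i _ hi
      rw [hk (Ne.symm hi), zero_mul]
    · simp
  refine ⟨{ toFun := fun x => WithLp.toLp 2 fun p => k.1 p.2 p.2 * x p
            map_add' := fun x y => by ext p; simp [mul_add]
            map_smul' := fun c x => by ext p; simp; ring
            norm_map' := fun x => ?_ }, fun S => ?_⟩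
  · simp [EuclideanSpace.norm_eq, mul_pow, hk1]
  · ext p
    have : (S.1 * k.1) p.1 p.2 = S.1 p.1 p.2 * k.1 p.2 p.2 := by
      rw [Matrix.mul_apply, Finset.sum_eq_single p.2]
      · intro i _ hi
        rw [hk hi, mul_zero]
      · simp
    simp [SO3.embed, SO3.entry, this]
    ring

/-! ### The differential of the double cover -/

theorem S3.mul_right_isometry (k : S3) :
    ∃ A : ℍ[ℝ] →ₗᵢ[ℝ] ℍ[ℝ], ∀ q : S3, ((q * k : S3) : ℍ[ℝ]) = A q :=
  ⟨{ LinearMap.mulRight ℝ (k : ℍ[ℝ]) with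
      norm_map' := fun x => by
        change ‖x * (k : ℍ[ℝ])‖ = ‖x‖
        rw [norm_mul, norm_eq_of_mem_sphere, mul_one] }, fun _ => rfl⟩

/-- Quaternion conjugation as a continuous linear map. -/
noncomputable def starQuaternion : ℍ[ℝ] →L[ℝ] ℍ[ℝ] :=
  LinearMap.toContinuousLinearMap
    { toFun := star
      map_add' := star_add
      map_smul' := fun r x => by ext <;> simp }

/-- The coordinates along `(i, j, k)` as continuous linear forms. -/
noncomputable def pureCoordL (a : Fin 3) : ℍ[ℝ] →L[ℝ] ℝ :=
  LinearMap.toContinuousLinearMap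
    { toFun := fun q => pureCoord q a
      map_add' := fun x y => by fin_cases a <;> simp [pureCoord]
      map_smul' := fun r x => by fin_cases a <;> simp [pureCoord] }

/-- On the sphere `q⁻¹ = star q`, so the entries of `B` extend to quadratic functions on all of `ℍ`,
where the product rule applies. -/
theorem fderiv_conjEntry (i j : Fin 3) (x : ℍ[ℝ]) :
    DifferentiableAt ℝ (fun y : ℍ[ℝ] => pureCoord (y * S3.unit j * star y) i) x ∧
    ∀ a, fderiv ℝ (fun y : ℍ[ℝ] => pureCoord (y * S3.unit j * star y) i) x a =
      pureCoord (a * S3.unit j * star x + x * S3.unit j * star a) i := by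
  have h1 := (hasFDerivAt_id (𝕜 := ℝ) x).mul_const' (S3.unit j : ℍ[ℝ])
  have h := (pureCoordL i).hasFDerivAt.comp x (h1.mul' (starQuaternion.hasFDerivAt (x := x)))
  refine ⟨h.differentiableAt, fun a => ?_⟩
  have he := h.fderiv
  have : fderiv ℝ (fun y : ℍ[ℝ] => pureCoord (y * S3.unit j * star y) i) x = _ := he
  rw [this]
  change pureCoord (x * S3.unit j * star a + a * S3.unit j * star x) i = _
  rw [add_comm]

/-- At `x = 1`, with `a = a₀ + α` and `b = b₀ + β`, the vectors are `2(a₀u + α × u)` and `2(b₀u + β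
× u)`; summing over `u = i, j, k` gives `12a₀b₀ + 8α·β`. The last term on the right is radial and
vanishes on vectors tangent to the sphere; the 8 cancels the `1 / 8` of `g8`. -/
theorem sum_pureCoord_mul_eq (x a b : ℍ[ℝ]) :
    ∑ i : Fin 3, ∑ j : Fin 3,
      pureCoord (a * S3.unit j * star x + x * S3.unit j * star a) i *
        pureCoord (b * S3.unit j * star x + x * S3.unit j * star b) i =
      8 * inner ℝ a b * inner ℝ x x + 4 * (inner ℝ a x * inner ℝ b x) := by
  simp only [Fin.sum_univ_three, Quaternion.inner_def]
  simp [pureCoord, S3.re_unit, S3.imI_unit, S3.imJ_unit, S3.imK_unit]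
  ring

theorem doubleCover_entry (i j : Fin 3) (q : S3) :
    SO3.entry i j (doubleCover q) = pureCoord ((q : ℍ[ℝ]) * S3.unit j * star (q : ℍ[ℝ])) i := by
  rw [← S3.coe_inv]
  rfl

theorem contMDiff_doubleCover : ContMDiff (𝓡 3) (𝓡 3) ∞ doubleCover := by
  refine SO3.contMDiff_of_entries fun i j => ?_
  have h : ContDiff ℝ ∞ fun y : ℍ[ℝ] => pureCoordL i (y * S3.unit j * starQuaternion y) :=
    (pureCoordL i).contDiff.comp ((contDiff_id.mul contDiff_const).mul starQuaternion.contDiff)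
  have hc := h.contMDiff.comp (contMDiff_coe_sphere (n := 3) (E := ℍ[ℝ]))
  refine hc.congr fun q => ?_
  exact doubleCover_entry i j q

theorem inner_coe_mvfderiv_coe (q : S3) (u : TangentSpace (𝓡 3) q) :
    inner ℝ (mvfderiv (𝓡 3) (fun p : S3 => (p : ℍ[ℝ])) q u) (q : ℍ[ℝ]) = 0 := by
  have h : mvfderiv (𝓡 3) ((↑) : S3 → ℍ[ℝ]) q u ∈
      (mvfderiv (𝓡 3) ((↑) : S3 → ℍ[ℝ]) q).range := ⟨u, rfl⟩
  rw [range_mvfderiv_subtypeVal] at h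
  rw [real_inner_comm]
  exact Submodule.mem_orthogonal_singleton_iff_inner_right.1 h

theorem g8_mfderiv_doubleCover (q : S3) (u v : TangentSpace (𝓡 3) q) :
    g8 (doubleCover q) (mfderiv (𝓡 3) (𝓡 3) doubleCover q u)
      (mfderiv (𝓡 3) (𝓡 3) doubleCover q v) = roundMetric q u v := by
  have hB := contMDiff_doubleCover.mdifferentiable (by simp) q
  have hc : MDifferentiableAt (𝓡 3) 𝓘(ℝ, ℍ[ℝ]) (fun p : S3 => (p : ℍ[ℝ])) q :=
    (contMDiff_coe_sphere (m := ∞)).mdifferentiable (by simp) q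
  have he : ∀ i j (w : TangentSpace (𝓡 3) q), mvfderiv (𝓡 3) (SO3.entry i j) (doubleCover q)
      (mfderiv (𝓡 3) (𝓡 3) doubleCover q w) =
      pureCoord (mvfderiv (𝓡 3) (fun p : S3 => (p : ℍ[ℝ])) q w * S3.unit j * star (q : ℍ[ℝ]) +
        q * S3.unit j * star (mvfderiv (𝓡 3) (fun p : S3 => (p : ℍ[ℝ])) q w)) i := by
    intro i j w
    obtain ⟨hd, hf⟩ := fderiv_conjEntry i j q
    have h1 := mfderiv_comp_apply q (SO3.mdifferentiable_entry i j _) hB w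
    have h2 := mfderiv_comp_apply q hd.mdifferentiableAt hc w
    have h3 : SO3.entry i j ∘ doubleCover =
        (fun y : ℍ[ℝ] => pureCoord (y * S3.unit j * star y) i) ∘ (fun p : S3 => (p : ℍ[ℝ])) :=
      funext (doubleCover_entry i j)
    rw [mfderiv_eq_fderiv] at h2
    rw [h3] at h1
    exact h1.symm.trans (h2.trans (hf _))
  rw [g8_eq_inner, PiLp.inner_apply, Fintype.sum_prod_type]
  simp only [SO3.mvfderiv_embed_apply, he, inner_inv_sqrt_eight_mul, ← Finset.mul_sum]
  rw [sum_pureCoord_mul_eq, inner_coe_mvfderiv_coe, inner_coe_mvfderiv_coe,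
    real_inner_self_eq_norm_sq, norm_eq_of_mem_sphere, roundMetric]
  ring

/-! ### Surjectivity, local sections and the preimage of the diagonal group -/

/-- The quaternion `1 + x₀ i + x₁ j + x₂ k`. -/
noncomputable def cayleyQuaternion (x : E3) : ℍ[ℝ] := ⟨1, x 0, x 1, x 2⟩

/-- The lift to `S³` of the rotation with Cayley parameter `x`: the normalization of
`1 + x₀ i + x₁ j + x₂ k`. -/
noncomputable def cayleyLift (x : E3) : S3 :=
  ⟨(√(1 + x 0 ^ 2 + x 1 ^ 2 + x 2 ^ 2))⁻¹ • cayleyQuaternion x, by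
    have hn : 0 < 1 + x 0 ^ 2 + x 1 ^ 2 + x 2 ^ 2 := by positivity
    have h : ‖cayleyQuaternion x‖ = √(1 + x 0 ^ 2 + x 1 ^ 2 + x 2 ^ 2) := by
      rw [← Real.sqrt_mul_self (norm_nonneg _), ← Quaternion.normSq_eq_norm_mul_self,
        Quaternion.normSq_def']
      simp [cayleyQuaternion]
    rw [mem_sphere_zero_iff_norm, norm_smul, h, norm_inv, Real.norm_eq_abs,
      abs_of_nonneg (Real.sqrt_nonneg _)]
    exact inv_mul_cancel₀ (Real.sqrt_pos.2 hn).ne'⟩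

theorem doubleCover_cayleyLift (x : E3) :
    doubleCover (cayleyLift x) = ⟨rodrigues x, rodrigues_mem x⟩ := by
  have hn : 0 < 1 + x 0 ^ 2 + x 1 ^ 2 + x 2 ^ 2 := by positivity
  -- The entries of the conjugation matrix are homogeneous quadratic, so only the square of the
  -- normalizing factor appears.
  have hs : (√(1 + x 0 ^ 2 + x 1 ^ 2 + x 2 ^ 2))⁻¹ ^ 2 = (1 + x 0 ^ 2 + x 1 ^ 2 + x 2 ^ 2)⁻¹ := by
    rw [inv_pow, Real.sq_sqrt hn.le]
  refine Subtype.ext ?_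
  change conjMatrix (cayleyLift x) = rodrigues x
  rw [conjMatrix_eq, rodrigues, ← hs]
  simp only [cayleyLift, Quaternion.re_smul, Quaternion.imI_smul, Quaternion.imJ_smul,
    Quaternion.imK_smul]
  ext i j
  fin_cases i <;> fin_cases j <;> simp [cayleyQuaternion] <;> ring

theorem contMDiff_cayleyLift : ContMDiff (𝓡 3) (𝓡 3) ∞ cayleyLift := by
  have hs : ContDiff ℝ ∞ fun x : E3 => (√(1 + x 0 ^ 2 + x 1 ^ 2 + x 2 ^ 2))⁻¹ := by
    refine ContDiff.inv (ContDiff.sqrt (by fun_prop) fun x => by positivity) fun x => ?_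
    exact (Real.sqrt_pos.2 (by positivity)).ne'
  have hv : ContDiff ℝ ∞ cayleyQuaternion := by
    have h : cayleyQuaternion = fun x : E3 =>
        1 + x 0 • (S3.unit 0 : ℍ[ℝ]) + x 1 • (S3.unit 1 : ℍ[ℝ]) + x 2 • (S3.unit 2 : ℍ[ℝ]) := by
      funext x
      ext <;> simp [cayleyQuaternion, S3.re_unit, S3.imI_unit, S3.imJ_unit, S3.imK_unit]
    rw [h]
    fun_prop
  exact ContMDiff.codRestrict_sphere (hs.smul hv).contMDiff fun x => (cayleyLift x).2

/-- Cayley lifts reach every `S` with `1 + tr S ≠ 0`. If `R` is not in the image, neither is any `R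
B(q)`, so `1 + tr (R B(q)) = 0` for `q = 1, i, j, k`. Since `B(1) + B(i) + B(j) + B(k) = 0`, adding
the four equations gives `4 = 0`. -/
theorem doubleCover_surjective : Function.Surjective doubleCover := by
  have hmem : ∀ S : SO3, 1 + S.1.trace ≠ 0 → ∃ q, doubleCover q = S := fun S hS =>
    ⟨cayleyLift (invRodrigues S.1), by
      rw [doubleCover_cayleyLift]
      exact Subtype.ext (rodrigues_invRodrigues S hS)⟩
  intro R
  by_contra hR
  have hz : ∀ q : S3, 1 + (R.1 * (doubleCover q).1).trace = 0 := by
    intro q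
    by_contra h
    obtain ⟨p, hp⟩ := hmem (R * doubleCover q) h
    exact hR ⟨p * q⁻¹, by rw [map_mul, map_inv, hp, mul_inv_cancel_right]⟩
  have h := hz 1
  have h0 := hz (S3.unit 0)
  have h1 := hz (S3.unit 1)
  have h2 := hz (S3.unit 2)
  rw [map_one] at h
  have hc : ∀ a, (doubleCover (S3.unit a)).1 = conjMatrix (S3.unit a) := fun _ => rfl
  rw [hc, conjMatrix_eq] at h0 h1 h2
  simp [Matrix.trace_fin_three, Matrix.mul_apply, Fin.sum_univ_three, S3.re_unit, S3.imI_unit,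
    S3.imJ_unit, S3.imK_unit] at h h0 h1 h2
  linarith

theorem exists_doubleCover_section (R : SO3) :
    ∃ τ : SO3 → S3, ContMDiffAt (𝓡 3) (𝓡 3) ∞ τ R ∧ ∀ᶠ S in nhds R, doubleCover (τ S) = S := by
  obtain ⟨q, hq⟩ := doubleCover_surjective R
  refine ⟨fun S => q * cayleyLift (SO3.chart R S), ?_, ?_⟩
  · have hc : ContMDiffAt (𝓡 3) 𝓘(ℝ, E3) ∞ (SO3.chart R) R :=
      (contMDiffOn_chart (I := 𝓡 3) (x := R)).contMDiffAt
        ((chartAt E3 R).open_source.mem_nhds (mem_chart_source E3 R))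
    exact contMDiffAt_const.mul (contMDiff_cayleyLift.contMDiffAt.comp R hc)
  · filter_upwards [(chartAt E3 R).open_source.mem_nhds (mem_chart_source E3 R)] with S hS
    rw [map_mul, doubleCover_cayleyLift, hq]
    exact (SO3.chart R).left_inv hS

theorem doubleCover_mem_diagTorus_iff (q : S3) : doubleCover q ∈ diagTorus ↔ q ∈ Q8 := by
  have hi : S3.unit 0 ∈ Q8 := Subgroup.subset_closure (by simp)
  have hj : S3.unit 1 ∈ Q8 := Subgroup.subset_closure (by simp)
  have hij : S3.unit 0 * S3.unit 1 = S3.unit 2 := by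
    refine Subtype.ext ?_
    rw [Metric.unitSphere.coe_mul]
    ext <;> simp [S3.re_unit, S3.imI_unit, S3.imJ_unit, S3.imK_unit]
  have hk : S3.unit 2 ∈ Q8 := hij ▸ mul_mem hi hj
  have hneg : ∀ p ∈ Q8, -p ∈ Q8 := fun p hp => by
    have h : -p = S3.unit 0 * S3.unit 0 * p := by
      refine Subtype.ext ?_
      rw [Metric.unitSphere.coe_mul, Metric.unitSphere.coe_mul]
      ext <;> simp [S3.re_unit, S3.imI_unit, S3.imJ_unit, S3.imK_unit]
    rw [h]
    exact mul_mem (mul_mem hi hi) hp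
  have hent : ∀ p : S3, (doubleCover p).1 = conjMatrix p := fun _ => rfl
  constructor
  · intro h
    have hd : ∀ i j, i ≠ j → conjMatrix q i j = 0 := fun i j hij => h hij
    rw [conjMatrix_eq] at hd
    have h01 := hd 0 1 (by decide)
    have h02 := hd 0 2 (by decide)
    have h10 := hd 1 0 (by decide)
    have h12 := hd 1 2 (by decide)
    have h20 := hd 2 0 (by decide)
    have h21 := hd 2 1 (by decide)
    simp at h01 h02 h10 h12 h20 h21
    have hn := S3.normSq q
    -- Sums and differences of the off-diagonal entries in transposed positions show that products
    -- of two distinct coordinates of `q` vanish. One nonzero coordinate `t` thus annihilates the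
    -- others and equals `±1`, so `q` is `±1`, `±i`, `±j` or `±k`.
    have key : ∀ t x y z : ℝ, t ^ 2 + x ^ 2 + y ^ 2 + z ^ 2 = 1 → t * x = 0 → t * y = 0 →
        t * z = 0 → t ≠ 0 → (t = 1 ∨ t = -1) ∧ x = 0 ∧ y = 0 ∧ z = 0 := by
      intro t x y z hn hx hy hz ht
      obtain rfl := (mul_eq_zero.1 hx).resolve_left ht
      obtain rfl := (mul_eq_zero.1 hy).resolve_left ht
      obtain rfl := (mul_eq_zero.1 hz).resolve_left ht
      exact ⟨mul_self_eq_one_iff.1 (by linarith), rfl, rfl, rfl⟩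
    have hmem : ∀ p ∈ Q8, (q = p ∨ q = -p) → q ∈ Q8 := by
      rintro p hp (rfl | rfl)
      · exact hp
      · exact hneg p hp
    by_cases h0 : q.1.re = 0
    · by_cases h1 : q.1.imI = 0
      · by_cases h2 : q.1.imJ = 0
        · have h3 : q.1.imK ≠ 0 := by
            intro h3
            simp [h0, h1, h2, h3] at hn
          obtain ⟨h3, -⟩ := key q.1.imK 0 0 0 (by simpa [h0, h1, h2] using hn) (by simp) (by simp)
            (by simp) h3
          refine hmem _ hk (h3.imp (fun h3 => ?_) fun h3 => ?_) <;> refine Subtype.ext ?_ <;>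
            ext <;> simp [S3.re_unit, S3.imI_unit, S3.imJ_unit, S3.imK_unit, h0, h1, h2, h3]
        · obtain ⟨h3, ha, hb, hc⟩ := key q.1.imJ q.1.re q.1.imI q.1.imK (by linarith)
            (by linarith) (by linarith) (by linarith) h2
          refine hmem _ hj (h3.imp (fun h3 => ?_) fun h3 => ?_) <;> refine Subtype.ext ?_ <;>
            ext <;> simp [S3.re_unit, S3.imI_unit, S3.imJ_unit, S3.imK_unit, ha, hb, hc, h3]
      · obtain ⟨h3, ha, hb, hc⟩ := key q.1.imI q.1.re q.1.imJ q.1.imK (by linarith)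
          (by linarith) (by linarith) (by linarith) h1
        refine hmem _ hi (h3.imp (fun h3 => ?_) fun h3 => ?_) <;> refine Subtype.ext ?_ <;>
          ext <;> simp [S3.re_unit, S3.imI_unit, S3.imJ_unit, S3.imK_unit, ha, hb, hc, h3]
    · obtain ⟨h3, ha, hb, hc⟩ := key q.1.re q.1.imI q.1.imJ q.1.imK (by linarith)
        (by linarith) (by linarith) (by linarith) h0
      refine hmem _ (one_mem _) (h3.imp (fun h3 => ?_) fun h3 => ?_) <;> refine Subtype.ext ?_ <;>
        ext <;> simp [ha, hb, hc, h3]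
  · intro hq
    have hle : Q8 ≤ diagTorus.comap doubleCover := by
      refine (Subgroup.closure_le _).2 ?_
      rintro p (rfl | rfl) i j hij
      · rw [hent, conjMatrix_eq]
        fin_cases i <;> fin_cases j <;> first | exact absurd rfl hij |
          simp [S3.re_unit, S3.imI_unit, S3.imJ_unit, S3.imK_unit]
      · rw [hent, conjMatrix_eq]
        fin_cases i <;> fin_cases j <;> first | exact absurd rfl hij |
          simp [S3.re_unit, S3.imI_unit, S3.imJ_unit, S3.imK_unit]
    exact hle hq

/-! ### The induced diffeomorphism and its isometry property -/

/-- The map `qQ₈ ↦ B(q)T` induced by the double cover `B`. -/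
noncomputable def flagMap : S3 ⧸ Q8 → SO3 ⧸ diagTorus :=
  Quotient.map' doubleCover fun p q h => by
    rw [QuotientGroup.leftRel_apply] at h ⊢
    rw [← map_inv, ← map_mul]
    exact (doubleCover_mem_diagTorus_iff _).2 h

theorem flagMap_mk (q : S3) : flagMap (q : S3 ⧸ Q8) = (doubleCover q : SO3 ⧸ diagTorus) := rfl

theorem flagMap_bijective : Function.Bijective flagMap := by
  constructor
  · intro x y h
    obtain ⟨p, rfl⟩ := QuotientGroup.mk_surjective x
    obtain ⟨q, rfl⟩ := QuotientGroup.mk_surjective y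
    rw [flagMap_mk, flagMap_mk, QuotientGroup.eq, ← map_inv, ← map_mul,
      doubleCover_mem_diagTorus_iff] at h
    exact QuotientGroup.eq.2 h
  · intro y
    obtain ⟨R, rfl⟩ := QuotientGroup.mk_surjective y
    obtain ⟨q, rfl⟩ := doubleCover_surjective R
    exact ⟨q, rfl⟩

/-- The diffeomorphism `S³/Q₈ → SO(3)/T` induced by the double cover. -/
noncomputable def flagDiffeomorph :
    Diffeomorph (𝓡 3) (𝓡 3) (S3 ⧸ Q8) (SO3 ⧸ diagTorus) ∞ where
  toEquiv := Equiv.ofBijective flagMap flagMap_bijective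
  contMDiff_toFun := by
    intro x
    obtain ⟨q, rfl⟩ := QuotientGroup.mk_surjective x
    exact contMDiffAt_of_comp_mk (E := E3) Q8
      (((isLocalDiffeomorph_mk (E := E3) diagTorus).contMDiff.comp contMDiff_doubleCover) q)
  contMDiff_invFun := by
    intro y
    obtain ⟨R, rfl⟩ := QuotientGroup.mk_surjective y
    obtain ⟨τ, hτ, hs⟩ := exists_doubleCover_section R
    refine contMDiffAt_of_comp_mk (E := E3) diagTorus ?_
    -- Near `R` the inverse, read on `SO3`, is a local section of `B` followed by the projection of
    -- `S3`.
    refine ((isLocalDiffeomorph_mk (E := E3) Q8).contMDiff.contMDiffAt.comp R hτ).congr_of_eventuallyEq ?_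
    filter_upwards [hs] with S hS
    refine (Equiv.symm_apply_eq (Equiv.ofBijective flagMap flagMap_bijective)).2 ?_
    change _ = flagMap (τ S : S3 ⧸ Q8)
    rw [flagMap_mk, hS]

theorem flagDiffeomorph_mk (q : S3) :
    flagDiffeomorph (q : S3 ⧸ Q8) = (doubleCover q : SO3 ⧸ diagTorus) := rfl

theorem isIsometry_flagDiffeomorph {gS : SmoothRiemannianMetric (S3 ⧸ Q8)}
    {gF : SmoothRiemannianMetric (SO3 ⧸ diagTorus)}
    (hS : IsRiemannianSubmersion roundMetric gS (fun q : S3 => (q : S3 ⧸ Q8)))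
    (hF : IsRiemannianSubmersion g8 gF (fun R : SO3 => (R : SO3 ⧸ diagTorus))) :
    IsIsometry gS gF flagDiffeomorph := by
  rw [isRiemannianSubmersion_mk_iff Q8 fun q u => by rw [roundMetric, map_zero, inner_zero_right]]
    at hS
  rw [isRiemannianSubmersion_mk_iff diagTorus fun R u => by
    rw [g8_eq_inner, map_zero, inner_zero_right]] at hF
  intro x u v
  obtain ⟨q, rfl⟩ := QuotientGroup.mk_surjective x
  have hl := isLocalDiffeomorph_mk (E := E3) Q8
  have hs := (hl.mfderivToContinuousLinearEquiv (by simp) q).surjective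
  obtain ⟨u, rfl⟩ := hs u
  obtain ⟨v, rfl⟩ := hs v
  -- This differentiates the commuting square of the two projections, `B` and the induced map,
  -- reducing the claim to `B` being a local isometry upstairs.
  have hd : ∀ w : TangentSpace (𝓡 3) q,
      mfderiv (𝓡 3) (𝓡 3) flagDiffeomorph (q : S3 ⧸ Q8)
        (mfderiv (𝓡 3) (𝓡 3) (QuotientGroup.mk : S3 → S3 ⧸ Q8) q w) =
      mfderiv (𝓡 3) (𝓡 3) (QuotientGroup.mk : SO3 → SO3 ⧸ diagTorus) (doubleCover q)
        (mfderiv (𝓡 3) (𝓡 3) doubleCover q w) := by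
    intro w
    have h1 := mfderiv_comp_apply q (flagDiffeomorph.contMDiff.mdifferentiable (by simp) _)
      (hl.contMDiff.mdifferentiable (by simp) q) w
    have h2 := mfderiv_comp_apply q
      ((isLocalDiffeomorph_mk (E := E3) diagTorus).contMDiff.mdifferentiable (by simp) _)
      (contMDiff_doubleCover.mdifferentiable (by simp) q) w
    exact h1.symm.trans h2
  have h := (hF (doubleCover q) (mfderiv (𝓡 3) (𝓡 3) doubleCover q u)
    (mfderiv (𝓡 3) (𝓡 3) doubleCover q v)).trans
      ((g8_mfderiv_doubleCover q u v).trans (hS q u v).symm)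
  rw [← hd, ← hd] at h
  exact h

end RealFlag

open RealFlag
theorem mainTheorem2 :
    ∃ (gS : SmoothRiemannianMetric (S3 ⧸ Q8)) (gF : SmoothRiemannianMetric (SO3 ⧸ diagTorus))
      (φ : Diffeomorph (𝓡 3) (𝓡 3) (S3 ⧸ Q8) (SO3 ⧸ diagTorus) ∞),
      (∀ g : SmoothRiemannianMetric (S3 ⧸ Q8),
        IsRiemannianSubmersion roundMetric g (fun q : S3 => (q : S3 ⧸ Q8)) ↔ g = gS) ∧
      (∀ g : SmoothRiemannianMetric (SO3 ⧸ diagTorus),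
        IsRiemannianSubmersion g8 g (fun R : SO3 => (R : SO3 ⧸ diagTorus)) ↔ g = gF) ∧
      (∀ q : S3, φ (q : S3 ⧸ Q8) = (doubleCover q : SO3 ⧸ diagTorus)) ∧
      IsIsometry gS gF φ := by
  obtain ⟨gS, hS⟩ := existsUnique_isRiemannianSubmersion_mk Q8 (gM := roundMetric)
    (F := fun q : S3 => (q : ℍ[ℝ])) contMDiff_coe_sphere injective_mvfderiv_subtypeVal_sphere
    (fun k _ => S3.mul_right_isometry k) fun _ _ _ => rfl
  obtain ⟨gF, hF⟩ := existsUnique_isRiemannianSubmersion_mk diagTorus (gM := g8)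
    SO3.contMDiff_embed SO3.mvfderiv_embed_injective SO3.embed_mul_diag g8_eq_inner
  exact ⟨gS, gF, flagDiffeomorph, hS, hF, flagDiffeomorph_mk,
    isIsometry_flagDiffeomorph ((hS gS).2 rfl) ((hF gF).2 rfl)⟩
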